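/- Let $\mathcal H_{AB}=\mathbb C^{d_A}\otimes\mathbb C^{d_B}$, $d=\min\{d_A,d_B\}$, and let $|\Psi\rangle\in\mathcal H_{AB}$ be a unit vector with Schmidt decomposition $|\Psi\rangle=\sum_{j=0}^{d-1}\sqrt{s_j}\,|\psi^A_j\rangle\otimes|\psi^B_j\rangle$, where $s_0\ge s_1\ge\dots\ge s_{d-1}\ge0$. Write $\Psi=|\Psi\rangle\langle\Psi|$. **Sets of states.** For $1\le r\le d-1$ let $\mathcal S_r$ be the set of convex combinations of pure states of Schmidt rank at most $r$. For a pure state let $\mathcal E_r$ be the sum of its $d-r$ smallest Schmidt coefficients, so that $\mathcal E_r(\Psi)=\sum_{j=r}^{d-1}s_j$. For a mixed state let $\mathcal E_r(\sigma)=\inf\sum_l p_l\mathcal E_r(\Psi_l)$ over all finite ensembles of pure states with $\sum_l p_l|\Psi_l\rangle\langle\Psi_l|=\sigma$. Put $\mathcal S_{\mathcal E_r}(E)=\{\sigma:\mathcal E_r(\sigma)\le E\}$ and $f_r(\Psi,E)=\max_{\sigma\in\mathcal S_{\mathcal E_r}(E)}\langle\Psi|\sigma|\Psi\rangle$. **Separation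 probabilities.** A verification operator of $|\Psi\rangle$ is an operator $\Omega$ with $0\le\Omega\le 1$ and $\Omega|\Psi\rangle=|\Psi\rangle$. It is *separable* if $\Omega$ and $1-\Omega$ are both proportional to separable states. It is *local* if the binary measurement $\{\Omega,1-\Omega\}$ can be realized by local operations and classical communication (LOCC) with finitely many rounds. It is *homogeneous* if $\Omega=\Psi+\beta(1-\Psi)$ for some $\beta\in[0,1)$. For a set $\mathcal S$ of states let $P_\Omega(\Psi,\mathcal S)=\max_{\sigma\in\mathcal S}\operatorname{tr}(\Omega\sigma)$. Let $P_{\rm sep}(\Psi,\mathcal S)$ and $P_{\rm LC}(\Psi,\mathcal S)$ be the infima of $P_\Omega(\Psi,\mathcal S)$ over the separable, respectively local, verification operators of $|\Psi\rangle$, and let $P^{\rm H}_{\rm sep}(\Psi,\mathcal S)$ and $P^{\rm H}_{\rm LC}(\Psi,\mathcal S)$ be the infima over those that are in addition homogeneous. **Theorem.** Let $1\le r\le d-1$ and write $\mathcal E_r=\mathcal E_r(\Psi)$. Then $$1-\mathcal E_r\le P_{\rm sep}(\Psi,\mathcal S_r)\le P_{\rm LC}(\Psi,\mathcal S_r)\le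 1-\frac{2\mathcal E_r}{2+s_0+s_1}\le\frac{2}{1+s_0}\,(1-\mathcal E_r),$$ $$1-\frac{\mathcal E_r}{1+\sqrt{s_0s_1}}=P^{\rm H}_{\rm sep}(\Psi,\mathcal S_r)\le P^{\rm H}_{\rm LC}(\Psi,\mathcal S_r)\le 1-\frac{2\mathcal E_r}{2+s_0+s_1}\le\frac{3}{2+s_0}\,P^{\rm H}_{\rm sep}(\Psi,\mathcal S_r).$$ If in addition $0\le E<\mathcal E_r$, then, with $\mathcal S=\mathcal S_{\mathcal E_r}(E)$ and $f=f_r(\Psi,E)$, one has $f=\bigl[\sqrt{\mathcal E_r E}+\sqrt{(1-\mathcal E_r)(1-E)}\,\bigr]^2$ and $$f\le P_{\rm sep}(\Psi,\mathcal S)\le P_{\rm LC}(\Psi,\mathcal S)\le\frac{2f+s_0+s_1}{2+s_0+s_1}\le\frac{2}{1+s_0}\,f,$$ $$\frac{f+\sqrt{s_0s_1}}{1+\sqrt{s_0s_1}}=P^{\rm H}_{\rm sep}(\Psi,\mathcal S)\le P^{\rm H}_{\rm LC}(\Psi,\mathcal S)\le\frac{2f+s_0+s_1}{2+s_0+s_1}\le\frac{3}{2+s_0}\,P^{\rm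 H}_{\rm sep}(\Psi,\mathcal S).$$ -/

import Mathlib

open scoped Kronecker ComplexOrder

noncomputable section

namespace QCert

/-- Ket vectors of the bipartite Hilbert space `ℂ^dA ⊗ ℂ^dB`, in the product basis `|jk⟩`. -/
abbrev Ket (dA dB : ℕ) := EuclideanSpace ℂ (Fin dA × Fin dB)

/-- Operators on `ℂ^dA ⊗ ℂ^dB`. -/
abbrev Op (dA dB : ℕ) := Matrix (Fin dA × Fin dB) (Fin dA × Fin dB) ℂ

/-- The operator `|ψ⟩⟨ψ|`. -/
def ketBra {dA dB : ℕ} (ψ : Ket dA dB) : Op dA dB :=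
  Matrix.vecMulVec ψ.ofLp (star ψ.ofLp)

/-- Quantum states (density operators). -/
def IsDensity {dA dB : ℕ} (σ : Op dA dB) : Prop :=
  σ.PosSemidef ∧ σ.trace = 1

/-! ### Schmidt decomposition and high-dimensional entanglement -/

/-- `ψ = ∑_{j<d} √(s j) a_j ⊗ b_j` with `d = min dA dB`, orthonormal `a_j`, orthonormal `b_j` and
`s 0 ≥ s 1 ≥ ⋯ ≥ s (d-1) ≥ 0`. Only the values `s j` with `j < d` matter. -/
def HasSchmidtSpectrum {dA dB : ℕ} (ψ : Ket dA dB) (s : ℕ → ℝ) : Prop :=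
  AntitoneOn s (Set.Iio (min dA dB)) ∧ (∀ j < min dA dB, 0 ≤ s j) ∧
  ∃ (a : Fin (min dA dB) → EuclideanSpace ℂ (Fin dA))
    (b : Fin (min dA dB) → EuclideanSpace ℂ (Fin dB)),
    Orthonormal ℂ a ∧ Orthonormal ℂ b ∧
    ∀ (i : Fin dA) (k : Fin dB),
      ψ (i, k) = ∑ j : Fin (min dA dB), (Real.sqrt (s j) : ℂ) * (a j i * b j k)

/-- The `j`-th largest Schmidt coefficient: the square of the `j`-th largest singular value of the
coefficient matrix of `ψ` in the product basis (zero for `j ≥ min dA dB`). -/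
def schmidtCoeff {dA dB : ℕ} (ψ : Ket dA dB) (j : ℕ) : ℝ :=
  ((Matrix.toEuclideanLin (Matrix.of fun (i : Fin dA) (k : Fin dB) => ψ (i, k))).singularValues j)
    ^ 2

/-- The number of nonzero Schmidt coefficients. -/
def schmidtRank {dA dB : ℕ} (ψ : Ket dA dB) : ℕ :=
  {j ∈ Finset.range (min dA dB) | schmidtCoeff ψ j ≠ 0}.card

/-- `S_r`: convex combinations of pure states of Schmidt rank at most `r`. -/
def schmidtSet (dA dB r : ℕ) : Set (Op dA dB) :=
  convexHull ℝ {σ | ∃ φ : Ket dA dB, ‖φ‖ = 1 ∧ schmidtRank φ ≤ r ∧ σ = ketBra φ}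

/-- `S_sep`: convex combinations of pure product states. -/
def separableStates (dA dB : ℕ) : Set (Op dA dB) :=
  convexHull ℝ {σ | ∃ (u : EuclideanSpace ℂ (Fin dA)) (v : EuclideanSpace ℂ (Fin dB))
    (φ : Ket dA dB), ‖u‖ = 1 ∧ ‖v‖ = 1 ∧ (∀ i k, φ (i, k) = u i * v k) ∧ σ = ketBra φ}

/-- `E_r` on pure states: the sum of the `d - r` smallest Schmidt coefficients. -/
def entPure {dA dB : ℕ} (r : ℕ) (φ : Ket dA dB) : ℝ :=
  ∑ j ∈ Finset.Ico r (min dA dB), schmidtCoeff φ j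

/-- `E_r` on general states: the convex roof over all ensembles of pure states. -/
def entMixed {dA dB : ℕ} (r : ℕ) (σ : Op dA dB) : ℝ :=
  sInf {x : ℝ | ∃ (n : ℕ) (p : Fin n → ℝ) (φ : Fin n → Ket dA dB),
    (∀ l, 0 ≤ p l) ∧ ∑ l, p l = 1 ∧ (∀ l, ‖φ l‖ = 1) ∧
    ∑ l, p l • ketBra (φ l) = σ ∧ x = ∑ l, p l * entPure r (φ l)}

/-- `S_{E_r}(E)`: states whose entanglement, measured by `E_r`, is at most `E`. -/
def limitedEntSet (dA dB r : ℕ) (E : ℝ) : Set (Op dA dB) :=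
  {σ | IsDensity σ ∧ entMixed r σ ≤ E}

/-- The maximum fidelity `F(Ψ, S) = max_{σ ∈ S} ⟨Ψ|σ|Ψ⟩`. -/
def maxFidelity {dA dB : ℕ} (ψ : Ket dA dB) (S : Set (Op dA dB)) : ℝ :=
  sSup ((fun σ : Op dA dB => (star ψ.ofLp ⬝ᵥ (Matrix.mulVec σ ψ.ofLp)).re) '' S)

/-! ### Verification operators -/

/-- `Ω` is a verification operator of `|ψ⟩`: an effect `0 ≤ Ω ≤ 1` with `Ω|ψ⟩ = |ψ⟩`. Such effects
form a convex set, so mixtures `∑ p_l Π_l` of tests with `Π_l|ψ⟩ = |ψ⟩` are included. -/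
def IsVerification {dA dB : ℕ} (ψ : Ket dA dB) (Ω : Op dA dB) : Prop :=
  Ω.PosSemidef ∧ (1 - Ω).PosSemidef ∧ Matrix.mulVec Ω ψ.ofLp = ψ.ofLp

/-- Operators proportional to separable states. -/
def IsSeparableOp {dA dB : ℕ} (X : Op dA dB) : Prop :=
  ∃ c : ℝ, 0 ≤ c ∧ ∃ σ ∈ separableStates dA dB, X = c • σ

/-- `IsLOCC T` says that the binary measurement `{T, 1 - T}` (with `T` the "pass" outcome) can be
realized by a protocol of local operations and classical communication with finitely many rounds.
In each round one party applies a local measurement with Kraus operators `K i` (the output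
dimension may depend on the outcome, so local ancillas and discarding are allowed) and announces
the outcome `i`; the rest of the protocol is conditioned on `i`. At the end the parties accept or
reject. Shared randomness is the case `K i = √(p i) • 1`. -/
inductive IsLOCC : ∀ {dA dB : ℕ}, Op dA dB → Prop
  | accept (dA dB : ℕ) : IsLOCC (1 : Op dA dB)
  | reject (dA dB : ℕ) : IsLOCC (0 : Op dA dB)
  | alice {dA dB n : ℕ} (d' : Fin n → ℕ) (K : ∀ i, Matrix (Fin (d' i)) (Fin dA) ℂ)
      (T : ∀ i, Op (d' i) dB) (hK : ∑ i, (K i).conjTranspose * K i = 1)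
      (hT : ∀ i, IsLOCC (T i)) :
      IsLOCC (∑ i, (K i ⊗ₖ (1 : Matrix (Fin dB) (Fin dB) ℂ)).conjTranspose * T i *
        (K i ⊗ₖ (1 : Matrix (Fin dB) (Fin dB) ℂ)))
  | bob {dA dB n : ℕ} (d' : Fin n → ℕ) (K : ∀ i, Matrix (Fin (d' i)) (Fin dB) ℂ)
      (T : ∀ i, Op dA (d' i)) (hK : ∑ i, (K i).conjTranspose * K i = 1)
      (hT : ∀ i, IsLOCC (T i)) :
      IsLOCC (∑ i, ((1 : Matrix (Fin dA) (Fin dA) ℂ) ⊗ₖ K i).conjTranspose * T i *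
        ((1 : Matrix (Fin dA) (Fin dA) ℂ) ⊗ₖ K i))

/-- Verification operators realizable by LOCC. -/
def IsLocalVerification {dA dB : ℕ} (ψ : Ket dA dB) (Ω : Op dA dB) : Prop :=
  IsVerification ψ Ω ∧ IsLOCC Ω

/-- Separable verification operators: `Ω` and `1 - Ω` are proportional to separable states. -/
def IsSepVerification {dA dB : ℕ} (ψ : Ket dA dB) (Ω : Op dA dB) : Prop :=
  IsVerification ψ Ω ∧ IsSeparableOp Ω ∧ IsSeparableOp (1 - Ω)

/-- `Ω = |ψ⟩⟨ψ| + β (1 - |ψ⟩⟨ψ|)` for some `β ∈ [0, 1)`. -/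
def IsHomogeneous {dA dB : ℕ} (ψ : Ket dA dB) (Ω : Op dA dB) : Prop :=
  ∃ β : ℝ, 0 ≤ β ∧ β < 1 ∧ Ω = ketBra ψ + β • (1 - ketBra ψ)

/-! ### Separation probabilities -/

/-- `P_Ω(Ψ, S) = max_{σ ∈ S} tr(Ω σ)`. -/
def passProb {dA dB : ℕ} (Ω : Op dA dB) (S : Set (Op dA dB)) : ℝ :=
  sSup ((fun σ : Op dA dB => (Ω * σ).trace.re) '' S)

/-- `P_sep(Ψ, S)`: minimum of `P_Ω(Ψ, S)` over separable verification operators. -/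
def Psep {dA dB : ℕ} (ψ : Ket dA dB) (S : Set (Op dA dB)) : ℝ :=
  sInf ((fun Ω => passProb Ω S) '' {Ω | IsSepVerification ψ Ω})

/-- `P_LC(Ψ, S)`: infimum of `P_Ω(Ψ, S)` over LOCC verification operators. -/
def PLC {dA dB : ℕ} (ψ : Ket dA dB) (S : Set (Op dA dB)) : ℝ :=
  sInf ((fun Ω => passProb Ω S) '' {Ω | IsLocalVerification ψ Ω})

/-- `P_sep^H(Ψ, S)`: minimum over homogeneous separable verification operators. -/
def PsepH {dA dB : ℕ} (ψ : Ket dA dB) (S : Set (Op dA dB)) : ℝ :=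
  sInf ((fun Ω => passProb Ω S) '' {Ω | IsSepVerification ψ Ω ∧ IsHomogeneous ψ Ω})

/-- `P_LC^H(Ψ, S)`: infimum over homogeneous LOCC verification operators. -/
def PLCH {dA dB : ℕ} (ψ : Ket dA dB) (S : Set (Op dA dB)) : ℝ :=
  sInf ((fun Ω => passProb Ω S) '' {Ω | IsLocalVerification ψ Ω ∧ IsHomogeneous ψ Ω})

/-- `f_r(Ψ, E) = F(Ψ, S_{E_r}(E))`. -/
def fr {dA dB : ℕ} (r : ℕ) (ψ : Ket dA dB) (E : ℝ) : ℝ :=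
  maxFidelity ψ (limitedEntSet dA dB r E)

end QCert

end

open QCert

/-! The adversary set `S` enters only through its maximum fidelity `F` with `ψ`. An effect fixing
`ψ` dominates the projector onto `ψ`, so every passing probability is at least `F`. For a
homogeneous effect the passing probability is affine in the fidelity, hence exactly `β + (1 - β) F`.
What remains is to compute `F`, to find the least `β` giving a separable operator, and to exhibit
one good `β` realizable by LOCC.

Fidelity. If `φ` has Schmidt coefficients `t`, then `|⟨ψ|φ⟩| ≤ ∑ √(s j) √(t j)`
(`norm_inner_le_sum_sqrt`), by linear programming duality for doubly substochastic matrices. A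
Cauchy–Schwarz inequality with one weight on the first `r` coefficients and another on the tail
(`fidelity_ketBra_le`) gives a bound affine in the tail weight of `φ`, so it survives averaging over
an ensemble. Rescaling the head and the tail of the spectrum of `ψ` attains it
(`exists_fidelity_eq`).

Constructions. In the Schmidt bases, average product projectors whose phases are `ω ^ (t * 2 ^ j)`
on one side and the conjugates on the other. A sum of two powers of two determines its exponents, so
only the diagonal and the entries `|jj⟩⟨j'j'|` survive (`sum_proj_kronecker_phaseVec`). Uniform
amplitudes on one side and `√s` on the other give a one-way LOCC test. Mixing it with its mirror
image and a computational-basis test yields `β = (s 0 + s 1) / (2 + s 0 + s 1)`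
(`isLOCC_homogeneous`). Amplitudes `s ^ (1/4)` on both sides show that `|ψ⟩⟨ψ| + √(s 0 * s 1)` is
separable, that is, `β = q / (1 + q)` with `q = √(s 0 * s 1)`.

Optimality. The partial transpose of a singlet projector on the two leading Schmidt directions is a
witness excluding smaller `β` (`le_of_isSeparableOp_homogeneousOp`). The final comparisons are
polynomial inequalities using `s 1 ≤ s 0 ≤ F ≤ 1`. -/

namespace QCert

noncomputable section

/-- The product vector `u ⊗ v`. -/
def tens {dA dB : ℕ} (u : EuclideanSpace ℂ (Fin dA)) (v : EuclideanSpace ℂ (Fin dB)) :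
    Ket dA dB :=
  WithLp.toLp 2 fun p => u p.1 * v p.2

lemma tens_apply {dA dB : ℕ} (u : EuclideanSpace ℂ (Fin dA)) (v : EuclideanSpace ℂ (Fin dB))
    (p : Fin dA × Fin dB) : tens u v p = u p.1 * v p.2 := rfl

lemma inner_tens {dA dB : ℕ} (u u' : EuclideanSpace ℂ (Fin dA))
    (v v' : EuclideanSpace ℂ (Fin dB)) :
    inner ℂ (tens u v) (tens u' v') = inner ℂ u u' * inner ℂ v v' := by
  simp only [PiLp.inner_apply, RCLike.inner_apply, tens_apply, map_mul]
  rw [Fintype.sum_prod_type, Finset.sum_mul_sum]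
  exact Finset.sum_congr rfl fun i _ => Finset.sum_congr rfl fun j _ => by ring

/-! ### Existence of the Schmidt decomposition -/

lemma exists_orthonormalBasis_of_orthonormal_on {n : ℕ} (v : Fin n → EuclideanSpace ℂ (Fin n))
    (S : Set (Fin n)) (h : ∀ i ∈ S, ∀ j ∈ S, inner ℂ (v i) (v j) = if i = j then (1 : ℂ) else 0) :
    ∃ b : OrthonormalBasis (Fin n) ℂ (EuclideanSpace ℂ (Fin n)), ∀ i ∈ S, b i = v i := by
  classical
  refine Orthonormal.exists_orthonormalBasis_extension_of_card_eq (by simp) ?_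
  rw [orthonormal_iff_ite]
  rintro ⟨i, hi⟩ ⟨j, hj⟩
  simpa [Subtype.ext_iff] using h i hi j hj

lemma schmidtCoeff_nonneg {dA dB : ℕ} (φ : Ket dA dB) (j : ℕ) : 0 ≤ schmidtCoeff φ j :=
  sq_nonneg _

lemma schmidtCoeff_antitone {dA dB : ℕ} (φ : Ket dA dB) : Antitone (schmidtCoeff φ) := by
  intro i j hij
  exact pow_le_pow_left₀ (LinearMap.singularValues_nonneg _ _)
    (LinearMap.singularValues_antitone _ hij) 2

/-- This is the singular value decomposition of the coefficient matrix `T`. The images under `T` of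
an eigenbasis `e` of `T†T` are orthogonal with norms the singular values; normalizing the nonzero
ones gives Alice's basis, and Bob's is the complex conjugate of `e`. -/
lemma hasSchmidtSpectrum_schmidtCoeff {dA dB : ℕ} (φ : Ket dA dB) :
    HasSchmidtSpectrum φ (schmidtCoeff φ) := by
  refine ⟨(schmidtCoeff_antitone φ).antitoneOn _, fun j _ => schmidtCoeff_nonneg φ j, ?_⟩
  set T := Matrix.toEuclideanLin (Matrix.of fun (i : Fin dA) (k : Fin dB) => φ (i, k)) with hT
  have hfr : Module.finrank ℂ (EuclideanSpace ℂ (Fin dB)) = dB := by simp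
  set e := T.isSymmetric_adjoint_comp_self.eigenvectorBasis hfr with he
  set σ : ℕ → ℝ := fun j => T.singularValues j with hσ
  have hinner : ∀ j k : Fin dB, inner ℂ (T (e j)) (T (e k))
      = if j = k then ((σ k : ℂ)) ^ 2 else 0 := by
    intro j k
    rw [← LinearMap.adjoint_inner_right]
    have h1 : (LinearMap.adjoint T) (T (e k)) = ((σ k ^ 2 : ℝ) : ℂ) • e k := by
      have := T.isSymmetric_adjoint_comp_self.apply_eigenvectorBasis hfr k
      rw [← T.sq_singularValues_fin hfr k] at this
      exact this
    rw [h1, inner_smul_right, orthonormal_iff_ite.mp e.orthonormal j k]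
    split_ifs <;> simp
  have hσB : ∀ j, dB ≤ j → σ j = 0 := fun j hj =>
    T.singularValues_of_finrank_le (by rw [hfr]; exact hj)
  have hσA : ∀ j, dA ≤ j → σ j = 0 := fun j hj => by
    refine T.singularValues_eq_zero_iff_le_finrank_range.mpr (le_trans ?_ hj)
    simpa using Submodule.finrank_le (LinearMap.range T)
  -- The value `0` for `j ≥ dB` is never used: the singular value vanishes there, so such `j` lie
  -- outside the set being extended.
  obtain ⟨c, hc⟩ := exists_orthonormalBasis_of_orthonormal_on
    (fun j : Fin dA => if h : j.val < dB then ((σ j : ℂ))⁻¹ • T (e ⟨j, h⟩) else 0)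
    {j | σ j ≠ 0} (by
      intro i hi j hj
      have hi' : i.val < dB := by by_contra h; exact hi (hσB _ (not_lt.mp h))
      have hj' : j.val < dB := by by_contra h; exact hj (hσB _ (not_lt.mp h))
      simp only [hi', hj', dif_pos, inner_smul_left, inner_smul_right, hinner]
      have : ((σ j : ℂ)) ≠ 0 := by exact_mod_cast hj
      by_cases hij : i = j
      · subst hij; simp; field_simp
      · have : ¬ (i.val = j.val) := fun h => hij (Fin.ext h)
        simp [hij, this])
  have hTe : ∀ j (hA : j < dA) (hB : j < dB), T (e ⟨j, hB⟩) = (σ j : ℂ) • c ⟨j, hA⟩ := by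
    intro j hA hB
    by_cases h0 : σ j = 0
    · have := hinner ⟨j, hB⟩ ⟨j, hB⟩
      simp only [h0, if_true, Complex.ofReal_zero] at this
      rw [h0]; simpa using this
    · have := hc ⟨j, hA⟩ h0
      simp only [hB, dif_pos] at this
      rw [this, smul_smul, mul_inv_cancel₀ (by exact_mod_cast h0), one_smul]
  refine ⟨fun j => c ⟨j, lt_of_lt_of_le j.2 (min_le_left _ _)⟩,
    fun j => WithLp.toLp 2 fun k => star (e ⟨j, lt_of_lt_of_le j.2 (min_le_right _ _)⟩ k), ?_, ?_, ?_⟩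
  · exact c.orthonormal.comp _ fun i j h => by simpa [Fin.ext_iff] using h
  · rw [orthonormal_iff_ite]
    intro i j
    have := orthonormal_iff_ite.mp e.orthonormal ⟨j, lt_of_lt_of_le j.2 (min_le_right _ _)⟩
      ⟨i, lt_of_lt_of_le i.2 (min_le_right _ _)⟩
    simp only [PiLp.inner_apply, RCLike.inner_apply, Fin.mk.injEq, ← Fin.ext_iff] at this ⊢
    simp only [eq_comm (a := i), ← this]
    refine Finset.sum_congr rfl fun k _ => ?_
    simp [mul_comm]
  · intro i k
    have hM : φ (i, k) = (T (EuclideanSpace.single k 1)) i := by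
      simp [hT]
    have hexp : T (EuclideanSpace.single k 1) = ∑ m : Fin dB, star (e m k) • T (e m) := by
      conv_lhs => rw [← e.sum_repr' (EuclideanSpace.single k 1)]
      rw [map_sum]
      refine Finset.sum_congr rfl fun m _ => ?_
      rw [map_smul, EuclideanSpace.inner_single_right]
      simp
    rw [hM, hexp]
    simp only [WithLp.ofLp_sum, Finset.sum_apply]
    -- The expansion runs over all of `Fin dB`; the terms beyond `min dA dB` vanish because the rank
    -- of `T` is at most `dA`.
    symm
    refine Fintype.sum_of_injective
      (fun j : Fin (min dA dB) => (⟨j, lt_of_lt_of_le j.2 (min_le_right _ _)⟩ : Fin dB))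
      (fun i j h => by simpa [Fin.ext_iff] using h) _ _ ?_ ?_
    · intro m hm
      have hm' : dA ≤ m.val := by
        by_contra h
        exact hm ⟨⟨m, lt_min (not_le.mp h) m.2⟩, rfl⟩
      have := hinner m m
      simp only [hσA _ hm', if_true, Complex.ofReal_zero] at this
      have h0 : T (e m) = 0 := by simpa using this
      simp [h0]
    · intro j
      rw [hTe j (lt_of_lt_of_le j.2 (min_le_left _ _)) (lt_of_lt_of_le j.2 (min_le_right _ _))]
      have : Real.sqrt (schmidtCoeff φ j) = σ j :=
        Real.sqrt_sq (LinearMap.singularValues_nonneg _ _)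
      rw [this]
      simp
      ring

/-! ### A von Neumann type inequality -/

/-- Dual potentials certifying optimality of the diagonal matching of two sorted sequences. -/
lemma exists_potentials (d : ℕ) (x y : ℕ → ℝ) (hx : Antitone x) (hy : Antitone y)
    (hx0 : ∀ j, 0 ≤ x j) (hy0 : ∀ j, 0 ≤ y j) :
    ∃ u v : ℕ → ℝ, (∀ j, 0 ≤ u j) ∧ (∀ j, 0 ≤ v j) ∧ (∀ j < d, ∀ k < d, x j * y k ≤ u j + v k) ∧
      ∀ j < d, u j + v j = x j * y j := by
  -- The potentials come from the discrete Leibniz rule: `x j * y j - x (j+1) * y (j+1)` splits into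
  -- `(x j - x (j+1)) * y j`, the decrement of `u`, and `(y j - y (j+1)) * x (j+1)`, the decrement
  -- of `v`. The constant in `u` is the boundary term at `d`.
  set u : ℕ → ℝ := fun j => ∑ i ∈ Finset.Ico j d, (x i - x (i + 1)) * y i + x d * y d with hu
  set v : ℕ → ℝ := fun j => ∑ i ∈ Finset.Ico j d, (y i - y (i + 1)) * x (i + 1) with hv
  have hxs : ∀ i, 0 ≤ x i - x (i + 1) := fun i => sub_nonneg.mpr (hx i.le_succ)
  have hys : ∀ i, 0 ≤ y i - y (i + 1) := fun i => sub_nonneg.mpr (hy i.le_succ)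
  have hus : ∀ j < d, u j = (x j - x (j + 1)) * y j + u (j + 1) := fun j hj => by
    simp only [hu, Finset.sum_eq_sum_Ico_succ_bot hj]; ring
  have hvs : ∀ j < d, v j = (y j - y (j + 1)) * x (j + 1) + v (j + 1) := fun j hj => by
    simp only [hv, Finset.sum_eq_sum_Ico_succ_bot hj]
  have hdiag : ∀ n j, j + n = d → u j + v j = x j * y j := by
    intro n
    induction n with
    | zero => intro j hj; simp at hj; subst hj; simp [hu, hv]
    | succ n ih =>
      intro j hj
      have := ih (j + 1) (by omega)
      rw [hus j (by omega), hvs j (by omega)]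
      linear_combination this
  -- Monotonicity allows the factor inside each telescoping sum to be replaced by its last value.
  -- Added to the diagonal identity at the larger index, this gives the off-diagonal constraint.
  have hu' : ∀ j n, j + n < d → u (j + n) + (x j - x (j + n)) * y (j + n) ≤ u j := by
    intro j n
    induction n with
    | zero => intro _; simp
    | succ n ih =>
      intro h
      have h1 := ih (by omega)
      have h2 := hus (j + n) (by omega)
      rw [← add_assoc]
      have h3 : (x j - x (j + n + 1)) * y (j + n + 1) ≤ (x j - x (j + n + 1)) * y (j + n) :=
        mul_le_mul_of_nonneg_left (hy (Nat.le_succ _)) (sub_nonneg.mpr (hx (by omega)))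
      linarith
  have hv' : ∀ j n, j + n < d → v (j + n) + (y j - y (j + n)) * x (j + n) ≤ v j := by
    intro j n
    induction n with
    | zero => intro _; simp
    | succ n ih =>
      intro h
      have h1 := ih (by omega)
      have h2 := hvs (j + n) (by omega)
      rw [← add_assoc]
      have h3 : (y j - y (j + n)) * x (j + n + 1) ≤ (y j - y (j + n)) * x (j + n) :=
        mul_le_mul_of_nonneg_left (hx (Nat.le_succ _)) (sub_nonneg.mpr (hy (by omega)))
      linarith
  refine ⟨u, v, fun j => ?_, fun j => ?_, fun j hj k hk => ?_, fun j hj => ?_⟩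
  · exact add_nonneg (Finset.sum_nonneg fun i _ => mul_nonneg (hxs i) (hy0 i))
      (mul_nonneg (hx0 d) (hy0 d))
  · exact Finset.sum_nonneg fun i _ => mul_nonneg (hys i) (hx0 _)
  · rcases le_total j k with h | h
    · obtain ⟨n, rfl⟩ := Nat.exists_eq_add_of_le h
      have h1 := hu' j n hk
      have h2 := hdiag (d - (j + n)) (j + n) (by omega)
      linarith
    · obtain ⟨n, rfl⟩ := Nat.exists_eq_add_of_le h
      have h1 := hv' k n hj
      have h2 := hdiag (d - (k + n)) (k + n) (by omega)
      linarith
  · exact hdiag (d - j) j (by omega)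

/-- Weak linear programming duality. Nonnegativity of the potentials is what permits row and column
sums below one. -/
lemma sum_substochastic_le {d : ℕ} (D : Fin d → Fin d → ℝ) (hD : ∀ j k, 0 ≤ D j k)
    (hrow : ∀ j, ∑ k, D j k ≤ 1) (hcol : ∀ k, ∑ j, D j k ≤ 1) (x y : ℕ → ℝ)
    (hx : Antitone x) (hy : Antitone y) (hx0 : ∀ j, 0 ≤ x j) (hy0 : ∀ j, 0 ≤ y j) :
    ∑ j, ∑ k, D j k * (x j * y k) ≤ ∑ j : Fin d, x j * y j := by
  obtain ⟨u, v, hu, hv, huv, hdiag⟩ := exists_potentials d x y hx hy hx0 hy0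
  calc ∑ j, ∑ k, D j k * (x j * y k) ≤ ∑ j, ∑ k, D j k * (u j + v k) :=
        Finset.sum_le_sum fun j _ => Finset.sum_le_sum fun k _ =>
          mul_le_mul_of_nonneg_left (huv j j.2 k k.2) (hD j k)
    _ = ∑ j, (∑ k, D j k) * u j + ∑ k, (∑ j, D j k) * v k := by
        simp only [mul_add, Finset.sum_add_distrib, Finset.sum_mul]
        congr 1
        exact Finset.sum_comm
    _ ≤ ∑ j : Fin d, u j + ∑ k : Fin d, v k := by
        refine add_le_add (Finset.sum_le_sum fun j _ => ?_) (Finset.sum_le_sum fun k _ => ?_)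
        · exact mul_le_of_le_one_left (hu j) (hrow j)
        · exact mul_le_of_le_one_left (hv k) (hcol k)
    _ = ∑ j : Fin d, x j * y j := by
        rw [← Finset.sum_add_distrib]
        exact Finset.sum_congr rfl fun j _ => hdiag j j.2

/-- The extension of `s` by zero beyond `d`. -/
def extZero (d : ℕ) (s : ℕ → ℝ) (j : ℕ) : ℝ := if j < d then s j else 0

lemma extZero_of_lt {d : ℕ} (s : ℕ → ℝ) {j : ℕ} (h : j < d) : extZero d s j = s j := if_pos h

lemma extZero_of_le {d : ℕ} (s : ℕ → ℝ) {j : ℕ} (h : d ≤ j) : extZero d s j = 0 :=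
  if_neg (not_lt.mpr h)

lemma extZero_nonneg {d : ℕ} {s : ℕ → ℝ} (h0 : ∀ j < d, 0 ≤ s j) (j : ℕ) : 0 ≤ extZero d s j := by
  unfold extZero; split_ifs with h
  exacts [h0 j h, le_rfl]

lemma extZero_antitone {d : ℕ} {s : ℕ → ℝ} (h : AntitoneOn s (Set.Iio d))
    (h0 : ∀ j < d, 0 ≤ s j) : Antitone (extZero d s) := by
  intro i j hij
  by_cases hj : j < d
  · rw [extZero_of_lt s hj, extZero_of_lt s (hij.trans_lt hj)]
    exact h (hij.trans_lt hj) hj hij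
  · rw [extZero_of_le s (not_lt.mp hj)]
    exact extZero_nonneg h0 i

/-! ### Overlap bound and uniqueness of the Schmidt coefficients -/

lemma eq_sum_tens {dA dB : ℕ} {ψ : Ket dA dB} {s : ℕ → ℝ}
    {a : Fin (min dA dB) → EuclideanSpace ℂ (Fin dA)}
    {b : Fin (min dA dB) → EuclideanSpace ℂ (Fin dB)}
    (h : ∀ (i : Fin dA) (k : Fin dB),
      ψ (i, k) = ∑ j : Fin (min dA dB), (Real.sqrt (s j) : ℂ) * (a j i * b j k)) :
    ψ = ∑ j : Fin (min dA dB), (Real.sqrt (s j) : ℂ) • tens (a j) (b j) := by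
  ext ⟨i, k⟩
  simp [h, tens_apply]

/-- Each overlap `|⟨a j, c k⟩| |⟨b j, e k⟩|` is at most the mean of the two squares, and by Bessel's
inequality these means form a doubly substochastic matrix. -/
lemma norm_inner_le_sum_sqrt {dA dB : ℕ} {ψ φ : Ket dA dB} {s t : ℕ → ℝ}
    (hψ : HasSchmidtSpectrum ψ s) (hφ : HasSchmidtSpectrum φ t) :
    ‖inner ℂ ψ φ‖ ≤ ∑ j : Fin (min dA dB), Real.sqrt (s j) * Real.sqrt (t j) := by
  obtain ⟨hs, hs0, a, b, ha, hb, hab⟩ := hψ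
  obtain ⟨ht, ht0, c, e, hc, he, hce⟩ := hφ
  set D : Fin (min dA dB) → Fin (min dA dB) → ℝ := fun j k =>
    (‖inner ℂ (a j) (c k)‖ ^ 2 + ‖inner ℂ (b j) (e k)‖ ^ 2) / 2 with hD
  have key := sum_substochastic_le D (fun j k => by positivity)
    (fun j => by
      have h1 := hc.sum_inner_products_le (a j) (s := Finset.univ)
      have h2 := he.sum_inner_products_le (b j) (s := Finset.univ)
      simp only [norm_inner_symm (c _), norm_inner_symm (e _), ha.1, hb.1] at h1 h2
      simp only [hD, ← Finset.sum_div, Finset.sum_add_distrib]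
      linarith)
    (fun k => by
      have h1 := ha.sum_inner_products_le (c k) (s := Finset.univ)
      have h2 := hb.sum_inner_products_le (e k) (s := Finset.univ)
      simp only [hc.1, he.1] at h1 h2
      simp only [hD, ← Finset.sum_div, Finset.sum_add_distrib]
      linarith)
    (fun j => Real.sqrt (extZero (min dA dB) s j)) (fun j => Real.sqrt (extZero (min dA dB) t j))
    (fun i j h => Real.sqrt_le_sqrt (extZero_antitone hs hs0 h))
    (fun i j h => Real.sqrt_le_sqrt (extZero_antitone ht ht0 h))
    (fun _ => Real.sqrt_nonneg _) (fun _ => Real.sqrt_nonneg _)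
  simp only [extZero_of_lt _ (Fin.is_lt _)] at key
  refine le_trans ?_ key
  rw [eq_sum_tens hab, eq_sum_tens hce, sum_inner]
  refine (norm_sum_le _ _).trans (Finset.sum_le_sum fun j _ => ?_)
  rw [inner_sum]
  refine (norm_sum_le _ _).trans (Finset.sum_le_sum fun k _ => ?_)
  rw [inner_smul_left, inner_smul_right, inner_tens]
  simp only [norm_mul, RCLike.norm_conj, Complex.norm_real, Real.norm_eq_abs,
    abs_of_nonneg (Real.sqrt_nonneg _)]
  have h := two_mul_le_add_sq ‖inner ℂ (a j) (c k)‖ ‖inner ℂ (b j) (e k)‖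
  calc _ = (‖inner ℂ (a j) (c k)‖ * ‖inner ℂ (b j) (e k)‖) *
        (Real.sqrt (s j) * Real.sqrt (t k)) := by ring
    _ ≤ _ := mul_le_mul_of_nonneg_right (by simp only [hD]; linarith) (by positivity)

lemma norm_sq_eq_sum_spectrum {dA dB : ℕ} {ψ : Ket dA dB} {s : ℕ → ℝ}
    (hψ : HasSchmidtSpectrum ψ s) : ‖ψ‖ ^ 2 = ∑ j : Fin (min dA dB), s j := by
  obtain ⟨hs, hs0, a, b, ha, hb, hab⟩ := hψ
  have h : (inner ℂ ψ ψ : ℂ) = ((∑ j : Fin (min dA dB), s j : ℝ) : ℂ) := by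
    conv_lhs => rw [eq_sum_tens hab]
    simp only [sum_inner, inner_sum, inner_smul_left, inner_smul_right, inner_tens,
      orthonormal_iff_ite.mp ha, orthonormal_iff_ite.mp hb]
    push_cast
    refine Finset.sum_congr rfl fun j _ => ?_
    rw [Finset.sum_eq_single j (fun k _ hk => by simp [hk]) (by simp)]
    simp only [Complex.conj_ofReal, if_true, mul_one]
    rw [← Complex.ofReal_mul, Real.mul_self_sqrt (hs0 j j.2)]
  have h' := congrArg Complex.re h
  rw [Complex.ofReal_re] at h'
  rw [← h', ← inner_self_eq_norm_sq (𝕜 := ℂ)]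
  rfl

/-- Uniqueness of the Schmidt coefficients. -/
lemma schmidtCoeff_eq {dA dB : ℕ} {φ : Ket dA dB} {t : ℕ → ℝ} (hφ : HasSchmidtSpectrum φ t)
    {j : ℕ} (hj : j < min dA dB) : schmidtCoeff φ j = t j := by
  set τ := schmidtCoeff φ
  have hτ := hasSchmidtSpectrum_schmidtCoeff φ
  have h1 := norm_inner_le_sum_sqrt hφ hτ
  have h2 : ‖inner ℂ φ φ‖ = ‖φ‖ ^ 2 := by
    rw [inner_self_eq_norm_sq_to_K]; simp
  have h3 := norm_sq_eq_sum_spectrum hφ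
  have h4 := norm_sq_eq_sum_spectrum hτ
  -- The overlap bound for `φ` with itself reads `‖φ‖² ≤ ∑ √(t j) √(τ j)`, while both spectra sum to
  -- `‖φ‖²`. This is equality in Cauchy–Schwarz and forces `t = τ`.
  have h5 : ∑ j : Fin (min dA dB), (Real.sqrt (t j) - Real.sqrt (τ j)) ^ 2 ≤ 0 := by
    have : ∀ j : Fin (min dA dB), (Real.sqrt (t j) - Real.sqrt (τ j)) ^ 2
        = t j + τ j - 2 * (Real.sqrt (t j) * Real.sqrt (τ j)) := fun j => by
      rw [sub_sq, Real.sq_sqrt (hφ.2.1 j j.2), Real.sq_sqrt (hτ.2.1 j j.2)]; ring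
    simp only [this, Finset.sum_sub_distrib, Finset.sum_add_distrib, ← Finset.mul_sum]
    linarith
  have h6 := (Finset.sum_eq_zero_iff_of_nonneg fun j _ => sq_nonneg _).mp
    (le_antisymm h5 (Finset.sum_nonneg fun j _ => sq_nonneg _)) ⟨j, hj⟩ (Finset.mem_univ _)
  have h7 : Real.sqrt (t j) = Real.sqrt (τ j) := by
    have := pow_eq_zero_iff (two_ne_zero) |>.mp h6
    exact sub_eq_zero.mp this
  exact ((Real.sqrt_inj (hφ.2.1 j hj) (hτ.2.1 j hj)).mp h7).symm

/-! ### Fidelities and ensembles -/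

/-- The fidelity `⟨ψ|σ|ψ⟩`. -/
def fidelity {dA dB : ℕ} (ψ : Ket dA dB) (σ : Op dA dB) : ℝ :=
  (star ψ.ofLp ⬝ᵥ (Matrix.mulVec σ ψ.ofLp)).re

lemma fidelity_add {dA dB : ℕ} (ψ : Ket dA dB) (σ τ : Op dA dB) :
    fidelity ψ (σ + τ) = fidelity ψ σ + fidelity ψ τ := by
  simp [fidelity, Matrix.add_mulVec]

lemma fidelity_smul {dA dB : ℕ} (ψ : Ket dA dB) (c : ℝ) (σ : Op dA dB) :
    fidelity ψ (c • σ) = c * fidelity ψ σ := by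
  simp [fidelity, Matrix.smul_mulVec]

lemma fidelity_sum {dA dB : ℕ} (ψ : Ket dA dB) {ι : Type*} (S : Finset ι) (σ : ι → Op dA dB) :
    fidelity ψ (∑ i ∈ S, σ i) = ∑ i ∈ S, fidelity ψ (σ i) := by
  simp [fidelity, Matrix.sum_mulVec, dotProduct_sum]

lemma star_dotProduct_eq_inner {dA dB : ℕ} (ψ φ : Ket dA dB) :
    star ψ.ofLp ⬝ᵥ φ.ofLp = inner ℂ ψ φ := by
  rw [EuclideanSpace.inner_eq_star_dotProduct, dotProduct_comm]

lemma fidelity_ketBra {dA dB : ℕ} (ψ φ : Ket dA dB) :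
    fidelity ψ (ketBra φ) = ‖inner ℂ ψ φ‖ ^ 2 := by
  rw [fidelity, ketBra, Matrix.vecMulVec_mulVec, op_smul_eq_smul, dotProduct_smul,
    star_dotProduct_eq_inner, star_dotProduct_eq_inner, ← inner_conj_symm φ ψ, smul_eq_mul,
    Complex.conj_mul']
  norm_cast

lemma isDensity_ketBra {dA dB : ℕ} {φ : Ket dA dB} (h : ‖φ‖ = 1) : IsDensity (ketBra φ) := by
  refine ⟨Matrix.posSemidef_vecMulVec_self_star _, ?_⟩
  rw [ketBra, Matrix.trace_vecMulVec, dotProduct_comm, star_dotProduct_eq_inner,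
    inner_self_eq_norm_sq_to_K, h]
  simp

lemma convex_isDensity (dA dB : ℕ) : Convex ℝ {σ : Op dA dB | IsDensity σ} := by
  rintro σ ⟨hσ, hσ1⟩ τ ⟨hτ, hτ1⟩ a b ha hb hab
  refine ⟨(hσ.smul ha).add (hτ.smul hb), ?_⟩
  rw [Matrix.trace_add, Matrix.trace_smul, Matrix.trace_smul, hσ1, hτ1, ← add_smul, hab, one_smul]

lemma isDensity_of_mem_schmidtSet {dA dB r : ℕ} {σ : Op dA dB} (h : σ ∈ schmidtSet dA dB r) :
    IsDensity σ := by
  refine convexHull_min ?_ (convex_isDensity dA dB) h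
  rintro _ ⟨φ, hφ, -, rfl⟩
  exact isDensity_ketBra hφ

/-- The spectral decomposition. Besides reducing traces to pure states, it shows that the infimum in
`entMixed` is over a nonempty set. -/
lemma exists_ensemble {dA dB : ℕ} {σ : Op dA dB} (h : IsDensity σ) :
    ∃ (n : ℕ) (p : Fin n → ℝ) (φ : Fin n → Ket dA dB),
      (∀ l, 0 ≤ p l) ∧ ∑ l, p l = 1 ∧ (∀ l, ‖φ l‖ = 1) ∧ ∑ l, p l • ketBra (φ l) = σ := by
  obtain ⟨hσ, htr⟩ := h
  set e := (Fintype.equivFin (Fin dA × Fin dB)).symm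
  refine ⟨_, fun l => hσ.isHermitian.eigenvalues (e l),
    fun l => hσ.isHermitian.eigenvectorBasis (e l),
    fun l => hσ.eigenvalues_nonneg _, ?_, fun l => ?_, ?_⟩
  · rw [hσ.isHermitian.trace_eq_sum_eigenvalues] at htr
    rw [e.sum_comp (fun i => hσ.isHermitian.eigenvalues i)]
    have h' := congrArg Complex.re htr
    simpa using h'
  · exact hσ.isHermitian.eigenvectorBasis.orthonormal.1 _
  · rw [e.sum_comp (fun i => hσ.isHermitian.eigenvalues i •
      ketBra (hσ.isHermitian.eigenvectorBasis i))]
    conv_rhs => rw [hσ.isHermitian.spectral_theorem]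
    ext i j
    rw [Matrix.sum_apply, Unitary.conjStarAlgAut_apply, Matrix.mul_apply]
    refine Finset.sum_congr rfl fun k _ => ?_
    simp only [Matrix.mul_diagonal, Matrix.star_apply, Matrix.smul_apply, ketBra,
      Matrix.vecMulVec_apply, Matrix.IsHermitian.eigenvectorUnitary_apply, Pi.star_apply,
      Function.comp_apply, Complex.real_smul]
    simp
    ring

lemma entPure_nonneg {dA dB : ℕ} (r : ℕ) (φ : Ket dA dB) : 0 ≤ entPure r φ :=
  Finset.sum_nonneg fun j _ => schmidtCoeff_nonneg φ j

lemma entMixed_ketBra_le {dA dB : ℕ} (r : ℕ) {φ : Ket dA dB} (h : ‖φ‖ = 1) :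
    entMixed r (ketBra φ) ≤ entPure r φ := by
  refine csInf_le ⟨0, ?_⟩ ⟨1, fun _ => 1, fun _ => φ, by simp, by simp, by simpa, by simp, by simp⟩
  rintro _ ⟨n, p, φ, hp, -, -, -, rfl⟩
  exact Finset.sum_nonneg fun l _ => mul_nonneg (hp l) (entPure_nonneg r _)

lemma exists_ensemble_entPure_lt {dA dB r : ℕ} {σ : Op dA dB} (h : IsDensity σ) {E : ℝ}
    (hE : entMixed r σ < E) :
    ∃ (n : ℕ) (p : Fin n → ℝ) (φ : Fin n → Ket dA dB),
      (∀ l, 0 ≤ p l) ∧ ∑ l, p l = 1 ∧ (∀ l, ‖φ l‖ = 1) ∧ ∑ l, p l • ketBra (φ l) = σ ∧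
      ∑ l, p l * entPure r (φ l) < E := by
  obtain ⟨n, p, φ, h1, h2, h3, h4⟩ := exists_ensemble h
  rw [entMixed] at hE
  obtain ⟨_, ⟨n, p, φ, h1, h2, h3, h4, rfl⟩, hx⟩ :=
    exists_lt_of_csInf_lt (by exact ⟨_, n, p, φ, h1, h2, h3, h4, rfl⟩) hE
  exact ⟨n, p, φ, h1, h2, h3, h4, hx⟩

/-- The coefficients are sorted, so the nonzero ones occupy an initial segment of indices. -/
lemma schmidtRank_le_iff {dA dB r : ℕ} (φ : Ket dA dB) :
    schmidtRank φ ≤ r ↔ entPure r φ = 0 := by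
  rw [entPure, Finset.sum_eq_zero_iff_of_nonneg fun j _ => schmidtCoeff_nonneg φ j, schmidtRank]
  constructor
  · intro h j hj
    rw [Finset.mem_Ico] at hj
    by_contra h0
    have hpos := lt_of_le_of_ne (schmidtCoeff_nonneg φ j) (Ne.symm h0)
    have hsub : Finset.range (j + 1) ⊆
        {j ∈ Finset.range (min dA dB) | schmidtCoeff φ j ≠ 0} := by
      intro i hi
      rw [Finset.mem_range] at hi
      rw [Finset.mem_filter, Finset.mem_range]
      exact ⟨by omega, (hpos.trans_le (schmidtCoeff_antitone φ (Nat.lt_succ_iff.mp hi))).ne'⟩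
    have := Finset.card_le_card hsub
    rw [Finset.card_range] at this
    omega
  · intro h
    have hsub : {j ∈ Finset.range (min dA dB) | schmidtCoeff φ j ≠ 0} ⊆ Finset.range r := by
      intro j hj
      rw [Finset.mem_filter, Finset.mem_range] at hj
      rw [Finset.mem_range]
      by_contra hjr
      exact hj.2 (h j (Finset.mem_Ico.mpr ⟨not_lt.mp hjr, hj.1⟩))
    simpa using Finset.card_le_card hsub

/-! ### Maximum fidelity with states of limited entanglement -/

lemma sum_range_add_sum_Ico {dA dB r : ℕ} (hrd : r < min dA dB) (f : ℕ → ℝ) :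
    ∑ j : Fin (min dA dB), f j = ∑ j ∈ Finset.range r, f j + ∑ j ∈ Finset.Ico r (min dA dB), f j := by
  rw [Fin.sum_univ_eq_sum_range, Finset.sum_range_add_sum_Ico _ hrd.le]

lemma sum_range_spectrum {dA dB r : ℕ} (hrd : r < min dA dB) {ψ : Ket dA dB} (hψ : ‖ψ‖ = 1)
    {s : ℕ → ℝ} (hs : HasSchmidtSpectrum ψ s) :
    ∑ j ∈ Finset.range r, s j = 1 - ∑ j ∈ Finset.Ico r (min dA dB), s j := by
  have h := norm_sq_eq_sum_spectrum hs
  rw [hψ, sum_range_add_sum_Ico hrd] at h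
  linarith

/-- Cauchy–Schwarz after writing `√s √t = √(w s) √(t / w)` with weight `w = m` on the first `r`
indices and `w = l` on the tail. The bound is affine in `entPure r φ`, and the weights remain free.
-/
lemma fidelity_ketBra_le {dA dB r : ℕ} (hrd : r < min dA dB) {ψ φ : Ket dA dB} (hψ : ‖ψ‖ = 1)
    (hφ : ‖φ‖ = 1) {s : ℕ → ℝ} (hs : HasSchmidtSpectrum ψ s) {Er : ℝ}
    (hEr : Er = ∑ j ∈ Finset.Ico r (min dA dB), s j) {l m : ℝ} (hl : 0 < l) (hm : 0 < m) :
    fidelity ψ (ketBra φ) ≤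
      (entPure r φ / l + (1 - entPure r φ) / m) * (l * Er + m * (1 - Er)) := by
  have ht := hasSchmidtSpectrum_schmidtCoeff φ
  set t := schmidtCoeff φ with htdef
  set w : ℕ → ℝ := fun j => if j < r then m else l with hw
  have hwpos : ∀ j, 0 < w j := fun j => by simp only [hw]; split_ifs <;> assumption
  have h1 := norm_inner_le_sum_sqrt hs ht
  have h2 := Finset.sum_mul_sq_le_sq_mul_sq Finset.univ
    (fun j : Fin (min dA dB) => Real.sqrt (w j * s j)) (fun j => Real.sqrt (t j / w j))
  have h3 : ∀ j : Fin (min dA dB), Real.sqrt (w j * s j) * Real.sqrt (t j / w j)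
      = Real.sqrt (s j) * Real.sqrt (t j) := fun j => by
    rw [← Real.sqrt_mul (mul_nonneg (hwpos j).le (hs.2.1 j j.2)),
      ← Real.sqrt_mul (hs.2.1 j j.2)]
    congr 1
    field_simp [(hwpos j).ne']
  have h4 : ∀ j : Fin (min dA dB), Real.sqrt (w j * s j) ^ 2 = w j * s j := fun j =>
    Real.sq_sqrt (mul_nonneg (hwpos j).le (hs.2.1 j j.2))
  have h5 : ∀ j : Fin (min dA dB), Real.sqrt (t j / w j) ^ 2 = t j / w j := fun j =>
    Real.sq_sqrt (div_nonneg (ht.2.1 j j.2) (hwpos j).le)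
  simp only [h3, h4, h5] at h2
  rw [sum_range_add_sum_Ico hrd (fun j => w j * s j),
    sum_range_add_sum_Ico hrd (fun j => t j / w j)] at h2
  have hwlow : ∀ j ∈ Finset.range r, w j = m := fun j hj => if_pos (Finset.mem_range.mp hj)
  have hwhigh : ∀ j ∈ Finset.Ico r (min dA dB), w j = l := fun j hj =>
    if_neg (not_lt.mpr (Finset.mem_Ico.mp hj).1)
  have e1 : ∑ j ∈ Finset.range r, w j * s j = m * (1 - Er) := by
    rw [hEr, ← sum_range_spectrum hrd hψ hs, Finset.mul_sum]
    exact Finset.sum_congr rfl fun j hj => by rw [hwlow j hj]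
  have e2 : ∑ j ∈ Finset.Ico r (min dA dB), w j * s j = l * Er := by
    rw [hEr, Finset.mul_sum]
    exact Finset.sum_congr rfl fun j hj => by rw [hwhigh j hj]
  have e3 : ∑ j ∈ Finset.range r, t j / w j = (1 - entPure r φ) / m := by
    rw [entPure, ← sum_range_spectrum hrd hφ ht, Finset.sum_div]
    exact Finset.sum_congr rfl fun j hj => by rw [hwlow j hj]
  have e4 : ∑ j ∈ Finset.Ico r (min dA dB), t j / w j = entPure r φ / l := by
    rw [entPure, Finset.sum_div]
    exact Finset.sum_congr rfl fun j hj => by rw [hwhigh j hj]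
  rw [e1, e2, e3, e4] at h2
  rw [fidelity_ketBra]
  calc _ ≤ (∑ j : Fin (min dA dB), Real.sqrt (s j) * Real.sqrt (t j)) ^ 2 :=
        pow_le_pow_left₀ (norm_nonneg _) h1 2
    _ ≤ _ := h2
    _ = _ := by ring

lemma fidelity_le_of_mem_schmidtSet {dA dB r : ℕ} (hrd : r < min dA dB) {ψ : Ket dA dB}
    (hψ : ‖ψ‖ = 1) {s : ℕ → ℝ} (hs : HasSchmidtSpectrum ψ s) {Er : ℝ}
    (hEr : Er = ∑ j ∈ Finset.Ico r (min dA dB), s j) {σ : Op dA dB}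
    (hσ : σ ∈ schmidtSet dA dB r) : fidelity ψ σ ≤ 1 - Er := by
  have hconv : Convex ℝ {σ : Op dA dB | fidelity ψ σ ≤ 1 - Er} := by
    intro σ hσ τ hτ a b ha hb hab
    simp only [Set.mem_ofPred_eq, fidelity_add, fidelity_smul] at *
    have h1 := mul_le_mul_of_nonneg_left hσ ha
    have h2 := mul_le_mul_of_nonneg_left hτ hb
    calc _ ≤ (a + b) * (1 - Er) := by linarith
      _ = _ := by rw [hab, one_mul]
  refine convexHull_min ?_ hconv hσ
  rintro _ ⟨φ, hφ, hr, rfl⟩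
  rw [schmidtRank_le_iff] at hr
  have hEr0 : 0 ≤ Er := hEr ▸ Finset.sum_nonneg fun j hj => hs.2.1 j (Finset.mem_Ico.mp hj).2
  change fidelity ψ (ketBra φ) ≤ 1 - Er
  refine le_of_forall_pos_le_add fun ε hε => ?_
  -- With no tail in `φ`, the bound is `l * Er + (1 - Er)`, and `l` may be taken arbitrarily small
  -- but not zero. The denominator `1 + Er` makes `l * Er ≤ ε` even if `Er = 0`.
  have h := fidelity_ketBra_le hrd hψ hφ hs hEr (l := ε / (1 + Er)) (m := 1) (by positivity)
    one_pos
  rw [hr] at h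
  have h2 : ε / (1 + Er) * Er ≤ ε := by
    rw [div_mul_eq_mul_div, div_le_iff₀ (by positivity)]
    nlinarith
  simp only [zero_div, sub_zero, div_one, zero_add, one_mul] at h
  linarith

/-- The maximum fidelity with a state whose Schmidt spectrum has tail weight `e`, against states
of tail weight `E`. -/
def fidelityBound (e E : ℝ) : ℝ := (Real.sqrt (e * E) + Real.sqrt ((1 - e) * (1 - E))) ^ 2

/-- The strict inequality `entMixed r σ < E` supplies an actual ensemble of mean entanglement below
`E`, although the infimum need not be attained; `0 < E` keeps the weight `l` positive. -/
lemma fidelity_le_fidelityBound {dA dB r : ℕ} (hrd : r < min dA dB) {ψ : Ket dA dB}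
    (hψ : ‖ψ‖ = 1) {s : ℕ → ℝ} (hs : HasSchmidtSpectrum ψ s) {Er : ℝ}
    (hEr : Er = ∑ j ∈ Finset.Ico r (min dA dB), s j) (hEr1 : Er < 1) {E : ℝ} (hE : 0 < E)
    (hEEr : E < Er) {σ : Op dA dB} (hσ : IsDensity σ) (hσE : entMixed r σ < E) :
    fidelity ψ σ ≤ fidelityBound Er E := by
  obtain ⟨n, p, φ, hp, hp1, hφ, rfl, hent⟩ := exists_ensemble_entPure_lt hσ hσE
  -- These weights make Cauchy–Schwarz tight for the optimal vector, whose tail is that of `ψ`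
  -- scaled by `l ^ 2` and whose head is scaled by `m ^ 2`.
  set l := Real.sqrt (E / Er) with hl
  set m := Real.sqrt ((1 - E) / (1 - Er)) with hm
  have hEr0 : 0 < Er := hE.trans hEEr
  have h1E : 0 < 1 - E := by linarith
  have h1Er : 0 < 1 - Er := by linarith
  have hl0 : 0 < l := Real.sqrt_pos.mpr (by positivity)
  have hm0 : 0 < m := Real.sqrt_pos.mpr (by positivity)
  have hl2 : l ^ 2 = E / Er := Real.sq_sqrt (by positivity)
  have hm2 : m ^ 2 = (1 - E) / (1 - Er) := Real.sq_sqrt (by positivity)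
  have hE' : E = l ^ 2 * Er := by rw [hl2]; field_simp
  have h1E' : 1 - E = m ^ 2 * (1 - Er) := by rw [hm2]; field_simp
  have hbound : fidelityBound Er E = (l * Er + m * (1 - Er)) ^ 2 := by
    rw [fidelityBound, h1E', show Er * E = (l * Er) ^ 2 by rw [hE']; ring,
      show (1 - Er) * (m ^ 2 * (1 - Er)) = (m * (1 - Er)) ^ 2 by ring,
      Real.sqrt_sq (by positivity), Real.sqrt_sq (by positivity)]
  have hl1 : l ≤ 1 := by
    exact Real.sqrt_le_one.mpr ((div_le_one hEr0).mpr hEEr.le)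
  have hm1 : 1 ≤ m := by
    rw [hm, Real.one_le_sqrt, one_le_div h1Er]; linarith
  -- Since `l ≤ 1 ≤ m`, the affine bound increases with the tail weight, so the ensemble mean may be
  -- replaced by `E`.
  have hslope : 0 ≤ 1 / l - 1 / m :=
    sub_nonneg.mpr (one_div_le_one_div_of_le hl0 (hl1.trans hm1))
  set e := ∑ i, p i * entPure r (φ i) with he
  calc fidelity ψ (∑ i, p i • ketBra (φ i)) = ∑ i, p i * fidelity ψ (ketBra (φ i)) := by
        simp only [fidelity_sum, fidelity_smul]
    _ ≤ ∑ i, p i * ((entPure r (φ i) / l + (1 - entPure r (φ i)) / m) *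
          (l * Er + m * (1 - Er))) :=
        Finset.sum_le_sum fun i _ => mul_le_mul_of_nonneg_left
          (fidelity_ketBra_le hrd hψ (hφ i) hs hEr hl0 hm0) (hp i)
    _ = ((1 / l - 1 / m) * e + (∑ i, p i) / m) * (l * Er + m * (1 - Er)) := by
        rw [he, Finset.mul_sum, Finset.sum_div, ← Finset.sum_add_distrib, Finset.sum_mul]
        exact Finset.sum_congr rfl fun i _ => by ring
    _ ≤ ((1 / l - 1 / m) * E + 1 / m) * (l * Er + m * (1 - Er)) := by
        rw [hp1]
        refine mul_le_mul_of_nonneg_right ?_ (by positivity)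
        exact add_le_add_left (mul_le_mul_of_nonneg_left hent.le hslope) _
    _ = (E / l + (1 - E) / m) * (l * Er + m * (1 - Er)) := by ring
    _ = fidelityBound Er E := by
        rw [hbound]
        have e1 : E / l = l * Er := by rw [div_eq_iff hl0.ne', hE']; ring
        have e2 : (1 - E) / m = m * (1 - Er) := by rw [div_eq_iff hm0.ne', h1E']; ring
        rw [e1, e2, sq]

/-- Letting `x` decrease to `E` and using continuity of the bound covers both `E = 0` and a convex
roof equal to `E`. -/
lemma fidelity_le_of_mem_limitedEntSet {dA dB r : ℕ} (hrd : r < min dA dB) {ψ : Ket dA dB}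
    (hψ : ‖ψ‖ = 1) {s : ℕ → ℝ} (hs : HasSchmidtSpectrum ψ s) {Er : ℝ}
    (hEr : Er = ∑ j ∈ Finset.Ico r (min dA dB), s j) (hEr1 : Er < 1) {E : ℝ} (hE : 0 ≤ E)
    (hEEr : E < Er) {σ : Op dA dB} (hσ : σ ∈ limitedEntSet dA dB r E) :
    fidelity ψ σ ≤ fidelityBound Er E := by
  have hcont : Continuous (fidelityBound Er) := by
    unfold fidelityBound; fun_prop
  refine ge_of_tendsto ((hcont.tendsto E).mono_left nhdsWithin_le_nhds :
    Filter.Tendsto _ (nhdsWithin E (Set.Ioi E)) _) ?_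
  filter_upwards [Ioo_mem_nhdsGT hEEr] with x hx
  exact fidelity_le_fidelityBound hrd hψ hs hEr hEr1 (hE.trans_lt hx.1) hx.2 hσ.1
    (hσ.2.trans_lt hx.1)

/-- Reusing the Schmidt bases of `ψ` gives equality in the overlap bound. -/
lemma HasSchmidtSpectrum.exists_inner_eq {dA dB : ℕ} {ψ : Ket dA dB} {s : ℕ → ℝ}
    (hs : HasSchmidtSpectrum ψ s) {t : ℕ → ℝ} (ht : AntitoneOn t (Set.Iio (min dA dB)))
    (ht0 : ∀ j < min dA dB, 0 ≤ t j) :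
    ∃ φ : Ket dA dB, HasSchmidtSpectrum φ t ∧
      inner ℂ ψ φ = ((∑ j : Fin (min dA dB), Real.sqrt (s j) * Real.sqrt (t j) : ℝ) : ℂ) := by
  obtain ⟨-, -, a, b, ha, hb, hab⟩ := hs
  refine ⟨∑ j : Fin (min dA dB), (Real.sqrt (t j) : ℂ) • tens (a j) (b j),
    ⟨ht, ht0, a, b, ha, hb, fun i k => by simp [tens_apply]⟩, ?_⟩
  rw [eq_sum_tens hab]
  simp only [sum_inner, inner_sum, inner_smul_left, inner_smul_right, inner_tens,
    orthonormal_iff_ite.mp ha, orthonormal_iff_ite.mp hb]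
  push_cast
  refine Finset.sum_congr rfl fun j _ => ?_
  rw [Finset.sum_eq_single j (fun k _ hk => by
    simp only [if_neg hk, mul_zero]) (by simp)]
  simp [mul_comm]

lemma exists_fidelity_eq {dA dB r : ℕ} (hrd : r < min dA dB) {ψ : Ket dA dB} (hψ : ‖ψ‖ = 1)
    {s : ℕ → ℝ} (hs : HasSchmidtSpectrum ψ s) {Er : ℝ}
    (hEr : Er = ∑ j ∈ Finset.Ico r (min dA dB), s j) (hEr1 : Er < 1) {E : ℝ} (hE : 0 ≤ E)
    (hEEr : E ≤ Er) :
    ∃ φ : Ket dA dB, ‖φ‖ = 1 ∧ entPure r φ = E ∧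
      fidelity ψ (ketBra φ) = fidelityBound Er E := by
  set c := E / Er with hc
  set c' := (1 - E) / (1 - Er) with hc'
  have hEr0 : 0 ≤ Er := hE.trans hEEr
  have h1Er : 0 < 1 - Er := by linarith
  -- If `Er = 0` then `E = 0` as well, and the convention `0 / 0 = 0` gives the right value.
  have hcE : c * Er = E := div_mul_cancel_of_imp fun h => by linarith
  have hcE' : c' * (1 - Er) = 1 - E := div_mul_cancel₀ _ h1Er.ne'
  have hc0 : 0 ≤ c := div_nonneg hE hEr0
  have hc1 : c ≤ 1 := div_le_one_of_le₀ hEEr hEr0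
  have hc1' : 1 ≤ c' := by rw [hc', one_le_div h1Er]; linarith
  have hs0 := hs.2.1
  set t : ℕ → ℝ := fun j => (if j < r then c' else c) * s j with ht
  have ht0 : ∀ j < min dA dB, 0 ≤ t j := fun j hj => by
    refine mul_nonneg ?_ (hs0 j hj)
    split_ifs <;> linarith
  -- Scaling the head by `c' ≥ 1` and the tail by `c ≤ 1` preserves the ordering, so the tail weight
  -- can be read off as `entPure`.
  have htanti : AntitoneOn t (Set.Iio (min dA dB)) := by
    intro i hi j hj hij
    refine mul_le_mul ?_ (hs.1 hi hj hij) (hs0 j hj) ?_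
    · split_ifs <;> first | omega | linarith
    · split_ifs <;> linarith
  have htlow : ∀ j ∈ Finset.range r, t j = c' * s j := fun j hj => by
    simp only [ht, if_pos (Finset.mem_range.mp hj)]
  have hthigh : ∀ j ∈ Finset.Ico r (min dA dB), t j = c * s j := fun j hj => by
    simp only [ht, if_neg (not_lt.mpr (Finset.mem_Ico.mp hj).1)]
  have hsum := sum_range_spectrum hrd hψ hs
  rw [← hEr] at hsum
  obtain ⟨φ, hφt, hinner⟩ := hs.exists_inner_eq htanti ht0
  refine ⟨φ, ?_, ?_, ?_⟩
  · have h := norm_sq_eq_sum_spectrum hφt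
    rw [sum_range_add_sum_Ico hrd, Finset.sum_congr rfl htlow, Finset.sum_congr rfl hthigh,
      ← Finset.mul_sum, ← Finset.mul_sum, hsum, ← hEr, hcE, hcE'] at h
    have : ‖φ‖ ^ 2 = 1 := by rw [h]; ring
    exact (pow_eq_one_iff_of_nonneg (norm_nonneg φ) two_ne_zero).mp this
  · rw [entPure, Finset.sum_congr rfl fun j hj => schmidtCoeff_eq hφt (Finset.mem_Ico.mp hj).2,
      Finset.sum_congr rfl hthigh, ← Finset.mul_sum, ← hEr, hcE]
  · rw [fidelity_ketBra, hinner, Complex.norm_real, Real.norm_eq_abs, sq_abs, fidelityBound]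
    congr 1
    rw [sum_range_add_sum_Ico hrd (fun j => Real.sqrt (s j) * Real.sqrt (t j)), add_comm]
    have key : ∀ x : ℝ, ∀ k : ℝ, 0 ≤ x → 0 ≤ k →
        Real.sqrt x * Real.sqrt (k * x) = Real.sqrt k * x := fun x k hx hk => by
      rw [Real.sqrt_mul hk, mul_left_comm, Real.mul_self_sqrt hx]
    congr 1
    · rw [Finset.sum_congr rfl fun j hj => by
        rw [hthigh j hj, key _ _ (hs0 j (Finset.mem_Ico.mp hj).2) hc0], ← Finset.mul_sum, ← hEr]
      rw [← key Er c hEr0 hc0, hcE, Real.sqrt_mul hEr0]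
    · rw [Finset.sum_congr rfl fun j hj => by
        rw [htlow j hj, key _ _ (hs0 j ((Finset.mem_range.mp hj).trans hrd))
          (zero_le_one.trans hc1')], ← Finset.mul_sum, hsum]
      rw [← key (1 - Er) c' h1Er.le (zero_le_one.trans hc1'), hcE', Real.sqrt_mul h1Er.le]

lemma fidelityBound_zero_right {e : ℝ} (he : e ≤ 1) : fidelityBound e 0 = 1 - e := by
  simp [fidelityBound, Real.sq_sqrt (sub_nonneg.mpr he)]

lemma isGreatest_fidelity_schmidtSet {dA dB r : ℕ} (hrd : r < min dA dB) {ψ : Ket dA dB}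
    (hψ : ‖ψ‖ = 1) {s : ℕ → ℝ} (hs : HasSchmidtSpectrum ψ s) {Er : ℝ}
    (hEr : Er = ∑ j ∈ Finset.Ico r (min dA dB), s j) (hEr1 : Er < 1) :
    IsGreatest (fidelity ψ '' schmidtSet dA dB r) (1 - Er) := by
  constructor
  · have hEr0 : 0 ≤ Er := hEr ▸ Finset.sum_nonneg fun j hj => hs.2.1 j (Finset.mem_Ico.mp hj).2
    obtain ⟨φ, h1, h2, h3⟩ := exists_fidelity_eq hrd hψ hs hEr hEr1 le_rfl hEr0
    exact ⟨ketBra φ, subset_convexHull _ _ ⟨φ, h1, (schmidtRank_le_iff φ).mpr h2, rfl⟩,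
      h3.trans (fidelityBound_zero_right hEr1.le)⟩
  · rintro _ ⟨σ, hσ, rfl⟩
    exact fidelity_le_of_mem_schmidtSet hrd hψ hs hEr hσ

lemma isGreatest_fidelity_limitedEntSet {dA dB r : ℕ} (hrd : r < min dA dB) {ψ : Ket dA dB}
    (hψ : ‖ψ‖ = 1) {s : ℕ → ℝ} (hs : HasSchmidtSpectrum ψ s) {Er : ℝ}
    (hEr : Er = ∑ j ∈ Finset.Ico r (min dA dB), s j) (hEr1 : Er < 1) {E : ℝ} (hE : 0 ≤ E)
    (hEEr : E < Er) :
    IsGreatest (fidelity ψ '' limitedEntSet dA dB r E) (fidelityBound Er E) := by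
  constructor
  · obtain ⟨φ, h1, h2, h3⟩ := exists_fidelity_eq hrd hψ hs hEr hEr1 hE hEEr.le
    exact ⟨ketBra φ, ⟨isDensity_ketBra h1, h2 ▸ entMixed_ketBra_le r h1⟩, h3⟩
  · rintro _ ⟨σ, hσ, rfl⟩
    exact fidelity_le_of_mem_limitedEntSet hrd hψ hs hEr hEr1 hE hEEr hσ

/-- The best vector with empty tail also lies in the larger set. This supplies `s 0 ≤ F` for the
final comparisons. -/
lemma one_sub_le_fidelityBound {dA dB r : ℕ} (hrd : r < min dA dB) {ψ : Ket dA dB}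
    (hψ : ‖ψ‖ = 1) {s : ℕ → ℝ} (hs : HasSchmidtSpectrum ψ s) {Er : ℝ}
    (hEr : Er = ∑ j ∈ Finset.Ico r (min dA dB), s j) (hEr1 : Er < 1) {E : ℝ} (hE : 0 ≤ E)
    (hEEr : E < Er) : 1 - Er ≤ fidelityBound Er E := by
  obtain ⟨φ, h1, h2, h3⟩ := exists_fidelity_eq hrd hψ hs hEr hEr1 le_rfl (hE.trans hEEr.le)
  rw [← fidelityBound_zero_right hEr1.le, ← h3]
  exact fidelity_le_of_mem_limitedEntSet hrd hψ hs hEr hEr1 hE hEEr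
    ⟨isDensity_ketBra h1, (h2 ▸ entMixed_ketBra_le r h1 : _ ≤ (0 : ℝ)).trans hE⟩

open Matrix

/-! ### The cone of unnormalized separable operators -/

/-- The rank-one operator `|v⟩⟨v|` of an unnormalized vector. -/
def proj {n : ℕ} (v : Fin n → ℂ) : Matrix (Fin n) (Fin n) ℂ := vecMulVec v (star v)

lemma conj_proj {m n : ℕ} (K : Matrix (Fin m) (Fin n) ℂ) (v : Fin n → ℂ) :
    K * proj v * Kᴴ = proj (K *ᵥ v) := by
  rw [proj, proj, mul_vecMulVec, vecMulVec_mul, star_mulVec]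

lemma smul_proj {n : ℕ} {c : ℝ} (hc : 0 ≤ c) (v : Fin n → ℂ) :
    c • proj v = proj (Real.sqrt c • v) := by
  rw [proj, proj, star_smul, star_trivial (Real.sqrt c), vecMulVec_smul, smul_vecMulVec, smul_smul,
    Real.mul_self_sqrt hc]

lemma sum_proj_single (n : ℕ) : ∑ i : Fin n, proj (Pi.single i 1) = 1 := by
  ext j k
  simp [Matrix.sum_apply, proj, vecMulVec_apply, Matrix.one_apply, Pi.single_apply]

/-- Finite sums of unnormalized product states. -/
def sepCone (dA dB : ℕ) : AddSubmonoid (Op dA dB) :=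
  AddSubmonoid.closure {X | ∃ (u : Fin dA → ℂ) (v : Fin dB → ℂ), X = proj u ⊗ₖ proj v}

lemma proj_kronecker_mem_sepCone {dA dB : ℕ} (u : Fin dA → ℂ) (v : Fin dB → ℂ) :
    proj u ⊗ₖ proj v ∈ sepCone dA dB :=
  AddSubmonoid.subset_closure ⟨u, v, rfl⟩

lemma smul_mem_sepCone {dA dB : ℕ} {c : ℝ} (hc : 0 ≤ c) {X : Op dA dB} (hX : X ∈ sepCone dA dB) :
    c • X ∈ sepCone dA dB := by
  induction hX using AddSubmonoid.closure_induction with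
  | mem x hx =>
    obtain ⟨u, v, rfl⟩ := hx
    rw [← smul_kronecker, smul_proj hc]
    exact proj_kronecker_mem_sepCone _ _
  | zero => rw [smul_zero]; exact zero_mem _
  | add x y _ _ hx hy => rw [smul_add]; exact add_mem hx hy

lemma one_mem_sepCone (dA dB : ℕ) : (1 : Op dA dB) ∈ sepCone dA dB := by
  have h : (1 : Op dA dB) = ∑ i : Fin dA, ∑ j : Fin dB,
      proj (Pi.single i 1) ⊗ₖ proj (Pi.single j 1) := by
    rw [← one_kronecker_one, ← sum_proj_single dA, ← sum_proj_single dB]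
    ext p q
    simp [Matrix.sum_apply, Finset.sum_mul_sum]
  rw [h]
  exact sum_mem fun i _ => sum_mem fun j _ => proj_kronecker_mem_sepCone _ _

lemma conj_kronecker_mem_sepCone {dA dB dA' dB' : ℕ} (K : Matrix (Fin dA') (Fin dA) ℂ)
    (L : Matrix (Fin dB') (Fin dB) ℂ) {X : Op dA dB} (hX : X ∈ sepCone dA dB) :
    (K ⊗ₖ L) * X * (K ⊗ₖ L)ᴴ ∈ sepCone dA' dB' := by
  induction hX using AddSubmonoid.closure_induction with
  | mem x hx =>
    obtain ⟨u, v, rfl⟩ := hx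
    rw [conjTranspose_kronecker, ← mul_kronecker_mul, ← mul_kronecker_mul, conj_proj, conj_proj]
    exact proj_kronecker_mem_sepCone _ _
  | zero => rw [Matrix.mul_zero, Matrix.zero_mul]; exact zero_mem _
  | add x y _ _ hx hy => rw [Matrix.mul_add, Matrix.add_mul]; exact add_mem hx hy

lemma conj_kronecker_mem_sepCone' {dA dB dA' dB' : ℕ} (K : Matrix (Fin dA) (Fin dA') ℂ)
    (L : Matrix (Fin dB) (Fin dB') ℂ) {X : Op dA dB} (hX : X ∈ sepCone dA dB) :
    (K ⊗ₖ L)ᴴ * X * (K ⊗ₖ L) ∈ sepCone dA' dB' := by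
  have h := conj_kronecker_mem_sepCone Kᴴ Lᴴ hX
  rwa [← conjTranspose_kronecker, conjTranspose_conjTranspose] at h

lemma one_sub_sum_conj {ι m : Type*} [Fintype ι] [Fintype m] [DecidableEq m] {n : ι → Type*}
    [∀ i, Fintype (n i)] [∀ i, DecidableEq (n i)] (K : ∀ i, Matrix (n i) m ℂ)
    (T : ∀ i, Matrix (n i) (n i) ℂ) (hK : ∑ i, (K i)ᴴ * K i = 1) :
    1 - ∑ i, (K i)ᴴ * T i * K i = ∑ i, (K i)ᴴ * (1 - T i) * K i := by
  rw [← hK, ← Finset.sum_sub_distrib]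
  exact Finset.sum_congr rfl fun i _ => by rw [Matrix.mul_sub, Matrix.sub_mul, Matrix.mul_one]

lemma sum_kronecker_one {dA dB n : ℕ} {d' : Fin n → ℕ}
    (K : ∀ i, Matrix (Fin (d' i)) (Fin dA) ℂ) (hK : ∑ i, (K i)ᴴ * K i = 1) :
    ∑ i, (K i ⊗ₖ (1 : Matrix (Fin dB) (Fin dB) ℂ))ᴴ * (K i ⊗ₖ (1 : Matrix (Fin dB) (Fin dB) ℂ)) = 1 := by
  simp only [conjTranspose_kronecker, ← mul_kronecker_mul, conjTranspose_one, mul_one]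
  rw [← one_kronecker_one, ← hK]
  ext p q
  simp [Matrix.sum_apply, Finset.sum_mul]

lemma sum_one_kronecker {dA dB n : ℕ} {d' : Fin n → ℕ}
    (K : ∀ i, Matrix (Fin (d' i)) (Fin dB) ℂ) (hK : ∑ i, (K i)ᴴ * K i = 1) :
    ∑ i, ((1 : Matrix (Fin dA) (Fin dA) ℂ) ⊗ₖ K i)ᴴ * ((1 : Matrix (Fin dA) (Fin dA) ℂ) ⊗ₖ K i) = 1 := by
  simp only [conjTranspose_kronecker, ← mul_kronecker_mul, conjTranspose_one, mul_one]
  rw [← one_kronecker_one, ← hK]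
  ext p q
  simp [Matrix.sum_apply, Finset.mul_sum]

/-- Induction on the rounds. Completeness of the Kraus operators turns the complement of a branching
test into the same sum of complements, so both claims propagate together. -/
lemma IsLOCC.mem_sepCone {dA dB : ℕ} {T : Op dA dB} (h : IsLOCC T) :
    T ∈ sepCone dA dB ∧ 1 - T ∈ sepCone dA dB := by
  induction h with
  | accept dA dB => exact ⟨one_mem_sepCone _ _, by rw [sub_self]; exact zero_mem _⟩
  | reject dA dB => exact ⟨zero_mem _, by rw [sub_zero]; exact one_mem_sepCone _ _⟩
  | alice d' K T hK hT ih =>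
    refine ⟨sum_mem fun i _ => conj_kronecker_mem_sepCone' _ _ (ih i).1, ?_⟩
    rw [one_sub_sum_conj _ T (sum_kronecker_one K hK)]
    exact sum_mem fun i _ => conj_kronecker_mem_sepCone' _ _ (ih i).2
  | bob d' K T hK hT ih =>
    refine ⟨sum_mem fun i _ => conj_kronecker_mem_sepCone' _ _ (ih i).1, ?_⟩
    rw [one_sub_sum_conj _ T (sum_one_kronecker K hK)]
    exact sum_mem fun i _ => conj_kronecker_mem_sepCone' _ _ (ih i).2

lemma ketBra_tens {dA dB : ℕ} (u : EuclideanSpace ℂ (Fin dA)) (v : EuclideanSpace ℂ (Fin dB)) :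
    ketBra (tens u v) = proj u.ofLp ⊗ₖ proj v.ofLp := by
  ext ⟨i, k⟩ ⟨j, l⟩
  simp only [ketBra, proj, kronecker_apply, vecMulVec_apply, Pi.star_apply, tens_apply, star_mul']
  ring

lemma ketBra_tens_mem_separableStates {dA dB : ℕ} {u : EuclideanSpace ℂ (Fin dA)}
    {v : EuclideanSpace ℂ (Fin dB)} (hu : ‖u‖ = 1) (hv : ‖v‖ = 1) :
    ketBra (tens u v) ∈ separableStates dA dB :=
  subset_convexHull _ _ ⟨u, v, tens u v, hu, hv, fun _ _ => rfl, rfl⟩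

lemma isSeparableOp_of_mem_sepCone {dA dB : ℕ} (hA : 0 < dA) (hB : 0 < dB) {X : Op dA dB}
    (hX : X ∈ sepCone dA dB) : IsSeparableOp X := by
  -- Positive dimensions are needed here: even the zero operator must be a multiple of some
  -- separable state.
  have hne : (separableStates dA dB).Nonempty :=
    ⟨_, ketBra_tens_mem_separableStates (u := EuclideanSpace.single ⟨0, hA⟩ 1)
      (v := EuclideanSpace.single ⟨0, hB⟩ 1) (by simp) (by simp)⟩
  have hzero : IsSeparableOp (0 : Op dA dB) := by
    obtain ⟨σ, hσ⟩ := hne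
    exact ⟨0, le_rfl, σ, hσ, by simp⟩
  induction hX using AddSubmonoid.closure_induction with
  | mem x hx =>
    obtain ⟨u, v, rfl⟩ := hx
    by_cases hu : u = 0
    · subst hu; simpa [proj] using hzero
    by_cases hv : v = 0
    · subst hv; simpa [proj] using hzero
    set u' : EuclideanSpace ℂ (Fin dA) := WithLp.toLp 2 u with hu'
    set v' : EuclideanSpace ℂ (Fin dB) := WithLp.toLp 2 v with hv'
    have hun : ‖u'‖ ≠ 0 := norm_ne_zero_iff.mpr fun h => hu (by simpa [hu'] using h)
    have hvn : ‖v'‖ ≠ 0 := norm_ne_zero_iff.mpr fun h => hv (by simpa [hv'] using h)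
    refine ⟨‖u'‖ ^ 2 * ‖v'‖ ^ 2, by positivity, _, ketBra_tens_mem_separableStates
      (u := ‖u'‖⁻¹ • u') (v := ‖v'‖⁻¹ • v') (by simp [norm_smul, hun])
      (by simp [norm_smul, hvn]), ?_⟩
    have eu : ‖u'‖ • (‖u'‖⁻¹ • u').ofLp = u := by
      rw [← WithLp.ofLp_smul, smul_inv_smul₀ hun]
    have ev : ‖v'‖ • (‖v'‖⁻¹ • v').ofLp = v := by
      rw [← WithLp.ofLp_smul, smul_inv_smul₀ hvn]
    rw [ketBra_tens, mul_smul, ← kronecker_smul, ← smul_kronecker, smul_proj (sq_nonneg _),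
      smul_proj (sq_nonneg _), Real.sqrt_sq (norm_nonneg _), Real.sqrt_sq (norm_nonneg _), eu, ev]
  | zero => exact hzero
  | add x y _ _ hx hy =>
    obtain ⟨c, hc, σ, hσ, rfl⟩ := hx
    obtain ⟨c', hc', τ, hτ, rfl⟩ := hy
    rcases (add_nonneg hc hc').eq_or_lt with h0 | h0
    · have h1 : c = 0 := by linarith
      have h2 : c' = 0 := by linarith
      simpa [h1, h2] using hzero
    · refine ⟨c + c', h0.le, (c / (c + c')) • σ + (c' / (c + c')) • τ,
        convex_convexHull ℝ _ hσ hτ (by positivity) (by positivity) (by field_simp), ?_⟩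
      rw [smul_add, smul_smul, smul_smul, mul_div_cancel₀ _ h0.ne', mul_div_cancel₀ _ h0.ne']

/-! ### Elementary LOCC protocols -/

lemma IsLOCC.mix {dA dB : ℕ} {S T : Op dA dB} (hS : IsLOCC S) (hT : IsLOCC T) {g : ℝ}
    (h0 : 0 ≤ g) (h1 : g ≤ 1) : IsLOCC (g • S + (1 - g) • T) := by
  have h := IsLOCC.alice (n := 2) (fun _ => dA)
    ![Real.sqrt g • (1 : Matrix (Fin dA) (Fin dA) ℂ), Real.sqrt (1 - g) • 1] ![S, T]
    (by
      simp only [Fin.sum_univ_two, Matrix.cons_val_zero, Matrix.cons_val_one, conjTranspose_smul,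
        conjTranspose_one, star_trivial, smul_mul_smul_comm, mul_one, Real.mul_self_sqrt h0,
        Real.mul_self_sqrt (sub_nonneg.mpr h1), ← add_smul, add_sub_cancel, one_smul])
    (by intro i; fin_cases i <;> assumption)
  convert h using 1
  simp only [Fin.sum_univ_two, Matrix.cons_val_zero, Matrix.cons_val_one, smul_kronecker,
    one_kronecker_one, conjTranspose_smul, conjTranspose_one, star_trivial, smul_mul_assoc, one_mul,
    mul_smul_comm, mul_one, smul_smul, Real.mul_self_sqrt h0,
    Real.mul_self_sqrt (sub_nonneg.mpr h1)]

lemma isLOCC_smul_one (dA dB : ℕ) {g : ℝ} (h0 : 0 ≤ g) (h1 : g ≤ 1) :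
    IsLOCC (g • (1 : Op dA dB)) := by
  simpa using (IsLOCC.accept dA dB).mix (IsLOCC.reject dA dB) h0 h1

/-- A local rank-one measurement of Alice, followed by a measurement of Bob. -/
lemma isLOCC_sum_proj_kronecker {dA dB : ℕ} {ι : Type*} [Fintype ι] (u : ι → Fin dA → ℂ)
    (hu : ∑ i, proj (u i) = 1) (N : ι → Matrix (Fin dB) (Fin dB) ℂ)
    (hN : ∀ i, IsLOCC ((1 : Matrix (Fin 1) (Fin 1) ℂ) ⊗ₖ N i)) :
    IsLOCC (∑ i, proj (u i) ⊗ₖ N i) := by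
  set e := (Fintype.equivFin ι).symm
  -- The Kraus operator is the bra of `u i`: Alice's system is left one-dimensional, and the rest of
  -- the protocol is Bob's.
  set K : ι → Matrix (Fin 1) (Fin dA) ℂ := fun i => Matrix.of fun _ j => star (u i j) with hK
  have hKK : ∀ i, (K i)ᴴ * K i = proj (u i) := fun i => by
    ext j k
    simp [hK, Matrix.mul_apply, proj, vecMulVec_apply]
  have h := IsLOCC.alice (dB := dB) (fun _ => 1) (fun i => K (e i))
    (fun i => (1 : Matrix (Fin 1) (Fin 1) ℂ) ⊗ₖ N (e i))
    (by rw [e.sum_comp (fun i => (K i)ᴴ * K i)]; simpa only [hKK] using hu) fun i => hN _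
  convert h using 1
  rw [e.sum_comp (fun i => (K i ⊗ₖ (1 : Matrix (Fin dB) (Fin dB) ℂ))ᴴ * (1 ⊗ₖ N i) * (K i ⊗ₖ 1))]
  refine Finset.sum_congr rfl fun i _ => ?_
  rw [conjTranspose_kronecker, ← mul_kronecker_mul, ← mul_kronecker_mul, conjTranspose_one,
    Matrix.one_mul, Matrix.mul_one, Matrix.mul_one, hKK]

/-- A local rank-one measurement of Bob, followed by a measurement of Alice. -/
lemma isLOCC_sum_kronecker_proj {dA dB : ℕ} {ι : Type*} [Fintype ι] (u : ι → Fin dB → ℂ)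
    (hu : ∑ i, proj (u i) = 1) (N : ι → Matrix (Fin dA) (Fin dA) ℂ)
    (hN : ∀ i, IsLOCC (N i ⊗ₖ (1 : Matrix (Fin 1) (Fin 1) ℂ))) :
    IsLOCC (∑ i, N i ⊗ₖ proj (u i)) := by
  set e := (Fintype.equivFin ι).symm
  set K : ι → Matrix (Fin 1) (Fin dB) ℂ := fun i => Matrix.of fun _ j => star (u i j) with hK
  have hKK : ∀ i, (K i)ᴴ * K i = proj (u i) := fun i => by
    ext j k
    simp [hK, Matrix.mul_apply, proj, vecMulVec_apply]
  have h := IsLOCC.bob (dA := dA) (fun _ => 1) (fun i => K (e i))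
    (fun i => N (e i) ⊗ₖ (1 : Matrix (Fin 1) (Fin 1) ℂ))
    (by rw [e.sum_comp (fun i => (K i)ᴴ * K i)]; simpa only [hKK] using hu) fun i => hN _
  convert h using 1
  rw [e.sum_comp (fun i => ((1 : Matrix (Fin dA) (Fin dA) ℂ) ⊗ₖ K i)ᴴ * (N i ⊗ₖ 1) * (1 ⊗ₖ K i))]
  refine Finset.sum_congr rfl fun i _ => ?_
  rw [conjTranspose_kronecker, ← mul_kronecker_mul, ← mul_kronecker_mul, conjTranspose_one,
    Matrix.one_mul, Matrix.mul_one, Matrix.mul_one, hKK]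

lemma proj_mul_proj {n : ℕ} {v : Fin n → ℂ} (hv : star v ⬝ᵥ v = 1) :
    proj v * proj v = proj v := by
  rw [proj, vecMulVec_mul_vecMulVec, hv, one_smul]

lemma conjTranspose_proj {n : ℕ} (v : Fin n → ℂ) : (proj v)ᴴ = proj v := by
  rw [proj, conjTranspose_vecMulVec, star_star]

lemma proj_completeness {n : ℕ} {v : Fin n → ℂ} (hv : star v ⬝ᵥ v = 1) :
    (proj v)ᴴ * proj v + (1 - proj v)ᴴ * (1 - proj v) = 1 := by
  rw [conjTranspose_sub, conjTranspose_one, conjTranspose_proj, mul_sub, sub_mul, mul_one, sub_mul,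
    one_mul, proj_mul_proj hv, Matrix.mul_one]
  abel

lemma isLOCC_one_kronecker_proj (dA : ℕ) {dB : ℕ} {v : Fin dB → ℂ} (hv : star v ⬝ᵥ v = 1) :
    IsLOCC ((1 : Matrix (Fin dA) (Fin dA) ℂ) ⊗ₖ proj v) := by
  have h := IsLOCC.bob (dA := dA) (n := 2) (fun _ => dB) ![proj v, 1 - proj v] ![1, 0]
    (by simpa [Fin.sum_univ_two] using proj_completeness hv)
    (by intro i; fin_cases i; exacts [IsLOCC.accept _ _, IsLOCC.reject _ _])
  convert h using 1
  simp only [Fin.sum_univ_two, Matrix.cons_val_zero, Matrix.cons_val_one, mul_one, mul_zero,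
    zero_mul, add_zero, conjTranspose_kronecker, ← mul_kronecker_mul, conjTranspose_one,
    conjTranspose_proj, proj_mul_proj hv]

lemma isLOCC_proj_kronecker_one (dB : ℕ) {dA : ℕ} {v : Fin dA → ℂ} (hv : star v ⬝ᵥ v = 1) :
    IsLOCC (proj v ⊗ₖ (1 : Matrix (Fin dB) (Fin dB) ℂ)) := by
  have h := IsLOCC.alice (dB := dB) (n := 2) (fun _ => dA) ![proj v, 1 - proj v] ![1, 0]
    (by simpa [Fin.sum_univ_two] using proj_completeness hv)
    (by intro i; fin_cases i; exacts [IsLOCC.accept _ _, IsLOCC.reject _ _])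
  convert h using 1
  simp only [Fin.sum_univ_two, Matrix.cons_val_zero, Matrix.cons_val_one, mul_one, mul_zero,
    zero_mul, add_zero, conjTranspose_kronecker, ← mul_kronecker_mul, conjTranspose_one,
    conjTranspose_proj, proj_mul_proj hv]

lemma proj_single {n : ℕ} (i : Fin n) : proj (Pi.single i 1) = Matrix.single i i (1 : ℂ) := by
  ext j k
  simp [proj, vecMulVec_apply, Matrix.single_apply, Pi.single_apply, ← ite_and, eq_comm, and_comm]

/-- Bob measures in the computational basis and accepts outcome `k` with probability `g k`. -/
lemma isLOCC_one_kronecker_sum (dA : ℕ) {dB : ℕ} {g : Fin dB → ℝ} (h0 : ∀ k, 0 ≤ g k)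
    (h1 : ∀ k, g k ≤ 1) :
    IsLOCC ((1 : Matrix (Fin dA) (Fin dA) ℂ) ⊗ₖ diagonal fun k => (g k : ℂ)) := by
  have h := isLOCC_sum_kronecker_proj (dA := dA) (dB := dB) (fun k => Pi.single k 1)
    (sum_proj_single dB) (fun k => g k • 1) (fun k => by
      rw [smul_kronecker, one_kronecker_one]
      exact isLOCC_smul_one _ _ (h0 k) (h1 k))
  convert h using 1
  ext ⟨i, k⟩ ⟨j, l⟩
  simp only [kronecker_apply, Matrix.sum_apply, proj_single, Matrix.smul_apply, Matrix.single_apply,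
    diagonal_apply]
  by_cases hkl : k = l
  · subst hkl
    rw [Finset.sum_eq_single k (fun m _ hm => by simp [hm]) (by simp)]
    simp [mul_comm]
  · rw [if_neg hkl, mul_zero, eq_comm]
    refine Finset.sum_eq_zero fun m _ => ?_
    rw [if_neg fun h => hkl (h.1.symm.trans h.2), mul_zero]

/-- Both parties measure in the computational basis and accept `(j, k)` with probability `g`. -/
lemma isLOCC_diagonal {dA dB : ℕ} {g : Fin dA × Fin dB → ℝ} (h0 : ∀ p, 0 ≤ g p)
    (h1 : ∀ p, g p ≤ 1) : IsLOCC (diagonal fun p => (g p : ℂ) : Op dA dB) := by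
  have h := isLOCC_sum_proj_kronecker (dA := dA) (dB := dB) (fun j => Pi.single j 1)
    (sum_proj_single dA) (fun j => diagonal fun k => (g (j, k) : ℂ)) (fun j =>
      isLOCC_one_kronecker_sum 1 (fun k => h0 (j, k)) fun k => h1 (j, k))
  convert h using 1
  ext ⟨i, k⟩ ⟨j, l⟩
  simp only [kronecker_apply, Matrix.sum_apply, proj_single, Matrix.single_apply, diagonal_apply,
    Prod.mk.injEq]
  by_cases hij : i = j
  · subst hij
    rw [Finset.sum_eq_single i (fun m _ hm => by simp [hm]) (by simp)]
    simp
  · rw [if_neg fun h => hij h.1, eq_comm]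
    refine Finset.sum_eq_zero fun m _ => ?_
    rw [if_neg fun h => hij (h.1.symm.trans h.2), zero_mul]

/-- Two one-outcome rounds with Kraus operators `Uᴴ` and `Vᴴ`; this allows working in the Schmidt
bases. -/
lemma IsLOCC.conj_unitary {dA dB : ℕ} {T : Op dA dB} (hT : IsLOCC T)
    {U : Matrix (Fin dA) (Fin dA) ℂ} {V : Matrix (Fin dB) (Fin dB) ℂ} (hU : U * Uᴴ = 1)
    (hV : V * Vᴴ = 1) : IsLOCC ((U ⊗ₖ V) * T * (U ⊗ₖ V)ᴴ) := by
  have h1 := IsLOCC.alice (n := 1) (fun _ => dA) (fun _ => Uᴴ) (fun _ => T) (by simpa) fun _ => hT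
  have h2 := IsLOCC.bob (n := 1) (fun _ => dB) (fun _ => Vᴴ) (fun _ => _) (by simpa) fun _ => h1
  convert h2 using 1
  have e1 : U ⊗ₖ V = (1 ⊗ₖ V) * (U ⊗ₖ 1) := by
    rw [← mul_kronecker_mul, one_mul, mul_one]
  rw [e1]
  simp only [Finset.univ_unique, Finset.sum_singleton, conjTranspose_mul, conjTranspose_kronecker,
    conjTranspose_conjTranspose, conjTranspose_one, Matrix.mul_assoc]

/-! ### Phase averaging -/

/-- Sums of two powers of two determine the exponents. -/
lemma two_pow_add_two_pow_inj {a b c d : ℕ} (h : 2 ^ a + 2 ^ b = 2 ^ c + 2 ^ d) :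
    (a = c ∧ b = d) ∨ (a = d ∧ b = c) := by
  -- If the larger exponent `b` exceeded `d`, then `2 ^ b` alone would already be at least `2 ^ c +
  -- 2 ^ d`.
  have key : ∀ {a b c d : ℕ}, a ≤ b → c ≤ d → 2 ^ a + 2 ^ b = 2 ^ c + 2 ^ d → b ≤ d := by
    intro a b c d _ hcd h
    by_contra! hlt
    have h1 : 2 ^ c ≤ 2 ^ d := Nat.pow_le_pow_right two_pos hcd
    have h2 : 2 ^ (d + 1) ≤ 2 ^ b := Nat.pow_le_pow_right two_pos hlt
    have h3 : 0 < 2 ^ a := Nat.two_pow_pos a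
    rw [pow_succ] at h2
    omega
  have sorted : ∀ {a b c d : ℕ}, a ≤ b → c ≤ d → 2 ^ a + 2 ^ b = 2 ^ c + 2 ^ d →
      a = c ∧ b = d := by
    intro a b c d hab hcd h
    obtain rfl : b = d := le_antisymm (key hab hcd h) (key hcd hab h.symm)
    exact ⟨Nat.pow_right_injective le_rfl (Nat.add_right_cancel h), rfl⟩
  rcases le_total a b with h1 | h1 <;> rcases le_total c d with h2 | h2
  · exact Or.inl (sorted h1 h2 h)
  · exact Or.inr (sorted h1 h2 (by omega))
  · exact Or.inr (sorted h1 h2 (by omega)).symm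
  · exact Or.inl (sorted h1 h2 (by omega)).symm

/-- The vector with amplitudes `α` and phases `ω ^ (t * 2 ^ j)`, `ω` a root of unity of order
`2 ^ (D + 2)`. -/
def phaseVec (D : ℕ) {n : ℕ} (α : Fin n → ℝ) (t : ZMod (2 ^ (D + 2))) : Fin n → ℂ :=
  fun j => α j * ZMod.stdAddChar (t * ((2 ^ (j : ℕ) : ℕ) : ZMod (2 ^ (D + 2))))

lemma proj_phaseVec_apply (D : ℕ) {n : ℕ} (α : Fin n → ℝ) (t : ZMod (2 ^ (D + 2)))
    (j j' : Fin n) : proj (phaseVec D α t) j j' =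
      (α j * α j' : ℝ) *
        ZMod.stdAddChar (t * (((2 ^ (j : ℕ) : ℕ) : ZMod (2 ^ (D + 2))) -
          ((2 ^ (j' : ℕ) : ℕ) : ZMod (2 ^ (D + 2))))) := by
  rw [proj, vecMulVec_apply, mul_sub, sub_eq_add_neg, AddChar.map_add_eq_mul,
    AddChar.map_neg_eq_conj]
  simp only [phaseVec, Pi.star_apply, star_mul', RCLike.star_def, Complex.conj_ofReal]
  push_cast
  ring

lemma star_phaseVec_dotProduct (D : ℕ) {n : ℕ} (α : Fin n → ℝ) (t : ZMod (2 ^ (D + 2))) :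
    star (phaseVec D α t) ⬝ᵥ phaseVec D α t = ((∑ j, α j ^ 2 : ℝ) : ℂ) := by
  rw [dotProduct, Complex.ofReal_sum]
  refine Finset.sum_congr rfl fun j _ => ?_
  have h := proj_phaseVec_apply D α t j j
  rw [proj, vecMulVec_apply, sub_self, mul_zero, AddChar.map_zero_eq_one, mul_one] at h
  rw [mul_comm, h, sq]

lemma sum_stdAddChar_mul {N : ℕ} [NeZero N] (m : ZMod N) :
    ∑ t : ZMod N, (ZMod.stdAddChar (t * m) : ℂ) = if m = 0 then (N : ℂ) else 0 := by
  rw [AddChar.sum_mulShift m (ZMod.isPrimitive_stdAddChar N), ZMod.card]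
  push_cast
  rfl

/-- For exponents below `D` both sums are at most `2 * 2 ^ D`, less than the modulus, so a
congruence is an equality of integers. -/
lemma natCast_two_pow_add_inj {D a b c d : ℕ} (ha : a < D) (hb : b < D) (hc : c < D) (hd : d < D)
    (h : ((2 ^ a + 2 ^ b : ℕ) : ZMod (2 ^ (D + 2))) = (2 ^ c + 2 ^ d : ℕ)) :
    (a = c ∧ b = d) ∨ (a = d ∧ b = c) := by
  have hlt : ∀ x < D, 2 ^ x ≤ 2 ^ D := fun x hx => Nat.pow_le_pow_right two_pos hx.le
  have h1 := hlt a ha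
  have h2 := hlt b hb
  have h3 := hlt c hc
  have h4 := hlt d hd
  have h5 : 2 ^ (D + 2) = 4 * 2 ^ D := by ring
  have h6 := Nat.two_pow_pos D
  rw [ZMod.natCast_eq_natCast_iff'] at h
  rw [Nat.mod_eq_of_lt (by omega), Nat.mod_eq_of_lt (by omega)] at h
  exact two_pow_add_two_pow_inj h

lemma sum_proj_phaseVec {D n : ℕ} (hn : n ≤ D) :
    ∑ t : ZMod (2 ^ (D + 2)),
      proj (phaseVec D (fun _ : Fin n => (Real.sqrt (2 ^ (D + 2) : ℕ))⁻¹) t) = 1 := by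
  ext j j'
  rw [Matrix.sum_apply]
  simp only [proj_phaseVec_apply]
  rw [← Finset.mul_sum, sum_stdAddChar_mul, ← mul_inv, Real.mul_self_sqrt (Nat.cast_nonneg _)]
  have hN : ((2 ^ (D + 2) : ℕ) : ℂ) ≠ 0 := by positivity
  by_cases h : j = j'
  · subst h
    rw [sub_self, if_pos rfl, one_apply_eq, Complex.ofReal_inv, Complex.ofReal_natCast,
      inv_mul_cancel₀ hN]
  · rw [if_neg, mul_zero, one_apply_ne h]
    intro h0
    refine h (Fin.ext ?_)
    have hj := j.2.trans_le hn
    have hj' := j'.2.trans_le hn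
    -- Adding `2 ^ j` to both sides reduces equality of single powers to the two-term statement.
    have := natCast_two_pow_add_inj hj hj hj' hj (by
      push_cast
      rw [sub_eq_zero] at h0
      push_cast at h0
      rw [h0])
    omega

/-- The sum over `t` keeps an entry only if `2 ^ j - 2 ^ j' = 2 ^ k - 2 ^ k'`. Rearranged to `2 ^ j
+ 2 ^ k' = 2 ^ j' + 2 ^ k`, this leaves only diagonal entries and those of the pattern `|jj⟩⟨j'j'|`.
-/
lemma sum_proj_kronecker_phaseVec {D dA dB : ℕ} (hA : dA ≤ D) (hB : dB ≤ D) (α : Fin dA → ℝ)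
    (β : Fin dB → ℝ) (j j' : Fin dA) (k k' : Fin dB) :
    (∑ t : ZMod (2 ^ (D + 2)), proj (phaseVec D α t) ⊗ₖ proj (phaseVec D β (-t))) (j, k) (j', k') =
      ((2 ^ (D + 2) : ℕ) * (α j * α j' * (β k * β k')) *
        if (j = j' ∧ k = k') ∨ ((j : ℕ) = k ∧ (j' : ℕ) = k') then 1 else 0 : ℝ) := by
  have hj := j.2.trans_le hA
  have hj' := j'.2.trans_le hA
  have hk := k.2.trans_le hB
  have hk' := k'.2.trans_le hB
  rw [Matrix.sum_apply]
  set m : ZMod (2 ^ (D + 2)) := (((2 ^ (j : ℕ) : ℕ) : ZMod (2 ^ (D + 2))) -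
          ((2 ^ (j' : ℕ) : ℕ) : ZMod (2 ^ (D + 2)))) -
    (((2 ^ (k : ℕ) : ℕ) : ZMod (2 ^ (D + 2))) -
          ((2 ^ (k' : ℕ) : ℕ) : ZMod (2 ^ (D + 2)))) with hm
  have h1 : ∀ t : ZMod (2 ^ (D + 2)),
      (proj (phaseVec D α t) ⊗ₖ proj (phaseVec D β (-t))) (j, k) (j', k') =
        (α j * α j' * (β k * β k') : ℝ) * ZMod.stdAddChar (t * m) := fun t => by
    rw [kronecker_apply, proj_phaseVec_apply, proj_phaseVec_apply, hm, mul_sub t (_ - _),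
      sub_eq_add_neg (t * _) (t * _), ← neg_mul, AddChar.map_add_eq_mul]
    push_cast
    ring
  simp only [h1]
  rw [← Finset.mul_sum, sum_stdAddChar_mul]
  have h2 : m = 0 ↔ (j = j' ∧ k = k') ∨ ((j : ℕ) = k ∧ (j' : ℕ) = k') := by
    constructor
    · intro h0
      have := natCast_two_pow_add_inj hj hk' hj' hk (by
        push_cast
        push_cast [hm] at h0
        linear_combination h0)
      simp only [Fin.ext_iff]
      omega
    · rintro (⟨rfl, rfl⟩ | ⟨h, h'⟩)
      · simp [hm]
      · rw [hm, h, h', sub_self]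
  simp only [h2]
  split_ifs <;> push_cast <;> ring

/-! ### The canonical form of a bipartite vector -/

/-- The vector `∑ j, √(s j) |jj⟩`. -/
def schmidtVec (dA dB : ℕ) (s : ℕ → ℝ) : Fin dA × Fin dB → ℂ :=
  fun p => if (p.1 : ℕ) = p.2 then (Real.sqrt (s p.1) : ℂ) else 0

lemma exists_unitary_of_orthonormal {n d : ℕ} (hd : d ≤ n) {a : Fin d → EuclideanSpace ℂ (Fin n)}
    (ha : Orthonormal ℂ a) :
    ∃ U : Matrix (Fin n) (Fin n) ℂ, U * Uᴴ = 1 ∧ ∀ i (j : Fin d), U i (Fin.castLE hd j) = a j i := by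
  obtain ⟨b, hb⟩ := exists_orthonormalBasis_of_orthonormal_on
    (fun j : Fin n => if h : j.val < d then a ⟨j, h⟩ else 0) {j | j.val < d} (by
      intro i hi j hj
      simp only [Set.mem_ofPred_eq] at hi hj
      simp only [hi, hj, dif_pos, orthonormal_iff_ite.mp ha, Fin.ext_iff])
  refine ⟨Matrix.of fun i j => b j i, ?_, fun i j => ?_⟩
  · rw [mul_eq_one_comm]
    ext j k
    have := orthonormal_iff_ite.mp b.orthonormal j k
    rw [Matrix.one_apply, ← this, Matrix.mul_apply, PiLp.inner_apply]
    refine Finset.sum_congr rfl fun i _ => ?_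
    simp [mul_comm]
  · have := hb (Fin.castLE hd j) j.2
    simp [Matrix.of_apply, this]

lemma HasSchmidtSpectrum.exists_unitary {dA dB : ℕ} {ψ : Ket dA dB} {s : ℕ → ℝ}
    (hs : HasSchmidtSpectrum ψ s) :
    ∃ (U : Matrix (Fin dA) (Fin dA) ℂ) (V : Matrix (Fin dB) (Fin dB) ℂ),
      U * Uᴴ = 1 ∧ V * Vᴴ = 1 ∧
      ψ.ofLp = (U ⊗ₖ V) *ᵥ schmidtVec dA dB (extZero (min dA dB) s) := by
  obtain ⟨-, -, a, b, ha, hb, hab⟩ := hs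
  obtain ⟨U, hU, hUa⟩ := exists_unitary_of_orthonormal (min_le_left dA dB) ha
  obtain ⟨V, hV, hVb⟩ := exists_unitary_of_orthonormal (min_le_right dA dB) hb
  refine ⟨U, V, hU, hV, ?_⟩
  ext ⟨i, k⟩
  rw [hab, mulVec, dotProduct]
  refine Fintype.sum_of_injective (fun j : Fin (min dA dB) =>
    (Fin.castLE (min_le_left dA dB) j, Fin.castLE (min_le_right dA dB) j))
    (fun i j h => by simpa [Fin.ext_iff] using h) _ _ ?_ fun j => ?_
  · rintro ⟨j, l⟩ hjl
    rw [schmidtVec, if_neg, mul_zero]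
    rintro (h : (j : ℕ) = l)
    exact hjl ⟨⟨j, lt_min j.2 (h ▸ l.2)⟩, by ext <;> simp [h]⟩
  · simp only [kronecker_apply, hUa, hVb, schmidtVec, Fin.val_castLE, if_true,
      extZero_of_lt s j.2]
    ring

lemma kronecker_mul_conjTranspose {dA dB : ℕ} {U : Matrix (Fin dA) (Fin dA) ℂ}
    {V : Matrix (Fin dB) (Fin dB) ℂ} (hU : U * Uᴴ = 1) (hV : V * Vᴴ = 1) :
    (U ⊗ₖ V) * (U ⊗ₖ V)ᴴ = 1 := by
  rw [conjTranspose_kronecker, ← mul_kronecker_mul, hU, hV, one_kronecker_one]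

lemma vecMulVec_mulVec_star {dA dB : ℕ} (W : Op dA dB) (x : Fin dA × Fin dB → ℂ) :
    vecMulVec (W *ᵥ x) (star (W *ᵥ x)) = W * vecMulVec x (star x) * Wᴴ := by
  rw [mul_vecMulVec, vecMulVec_mul, star_mulVec]

lemma sum_extZero {d n : ℕ} (h : d ≤ n) (s : ℕ → ℝ) :
    ∑ j : Fin n, extZero d s j = ∑ j : Fin d, s j := by
  symm
  refine Fintype.sum_of_injective (Fin.castLE h) (Fin.castLE_injective h) _ _ ?_ fun j => ?_
  · intro j hj
    refine extZero_of_le s ?_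
    by_contra hlt
    exact hj ⟨⟨j, not_le.mp hlt⟩, rfl⟩
  · exact (extZero_of_lt s j.2).symm

lemma schmidtVec_projection_apply {dA dB : ℕ} {s : ℕ → ℝ} (j j' : Fin dA) (k k' : Fin dB) :
    vecMulVec (schmidtVec dA dB s) (star (schmidtVec dA dB s)) (j, k) (j', k') =
      (if (j : ℕ) = k ∧ (j' : ℕ) = k' then Real.sqrt (s j) * Real.sqrt (s j') else 0 : ℝ) := by
  simp only [vecMulVec_apply, schmidtVec, Pi.star_apply]
  split_ifs <;> simp_all

/-! ### The optimal homogeneous LOCC verification operator -/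

lemma add_le_first_two {s : ℕ → ℝ} (hs : Antitone s) {j k : ℕ} (h : j ≠ k) :
    s j + s k ≤ s 0 + s 1 := by
  rcases lt_or_gt_of_ne h with h | h
  · exact add_le_add (hs (Nat.zero_le _)) (hs (by omega))
  · rw [add_comm]
    exact add_le_add (hs (Nat.zero_le _)) (hs (by omega))

/-- Writing `Ψ` for the projector onto the vector, the two one-way tests equal `Ψ` plus `s k`,
respectively `s j`, on each `|jk⟩` with `j ≠ k`. Their average has the uneven diagonal `(s j + s k)
/ 2`, which a classical test levels out. -/
lemma isLOCC_homogeneous_schmidtVec {dA dB : ℕ} {s : ℕ → ℝ} (hs : Antitone s)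
    (hs0 : ∀ j, 0 ≤ s j) (hpos : 0 < s 0) (hA : ∑ j : Fin dA, s j = 1)
    (hB : ∑ j : Fin dB, s j = 1) :
    IsLOCC (vecMulVec (schmidtVec dA dB s) (star (schmidtVec dA dB s)) +
      ((s 0 + s 1) / (2 + s 0 + s 1)) •
        (1 - vecMulVec (schmidtVec dA dB s) (star (schmidtVec dA dB s)))) := by
  set D := max dA dB
  have hDA : dA ≤ D := le_max_left _ _
  have hDB : dB ≤ D := le_max_right _ _
  have hs1 := hs0 1
  -- The acceptance probability off the matching outcomes is chosen so that, after mixing, the total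
  -- weight on `|jk⟩` no longer depends on `j` and `k`. It is nonnegative because `s 0 + s 1` is the
  -- largest sum of two distinct coefficients.
  set g : Fin dA × Fin dB → ℝ := fun p =>
    if (p.1 : ℕ) = p.2 then 1 else 1 - (s p.1 + s p.2) / (s 0 + s 1) with hg
  have hS : 0 < s 0 + s 1 := by linarith
  have hdiag : IsLOCC (diagonal fun p => (g p : ℂ) : Op dA dB) := by
    refine isLOCC_diagonal (fun p => ?_) fun p => ?_
    · simp only [hg]
      split_ifs with h
      · exact zero_le_one
      · exact sub_nonneg.mpr ((div_le_one hS).mpr (add_le_first_two hs h))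
    · simp only [hg]
      split_ifs with h
      · exact le_rfl
      · exact sub_le_self _ (div_nonneg (add_nonneg (hs0 _) (hs0 _)) hS.le)
  have hnorm : ∀ {n : ℕ} (t : ZMod (2 ^ (D + 2))), ∑ j : Fin n, s j = 1 →
      star (phaseVec D (fun j : Fin n => Real.sqrt (s j)) t) ⬝ᵥ
        phaseVec D (fun j : Fin n => Real.sqrt (s j)) t = 1 := fun t h => by
    rw [star_phaseVec_dotProduct]
    simp only [Real.sq_sqrt (hs0 _), h, Complex.ofReal_one]
  have hright := isLOCC_sum_proj_kronecker _ (sum_proj_phaseVec hDA)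
    (fun t => proj (phaseVec D (fun k : Fin dB => Real.sqrt (s k)) (-t)))
    fun t => isLOCC_one_kronecker_proj 1 (hnorm (-t) hB)
  have hleft := isLOCC_sum_kronecker_proj _ (sum_proj_phaseVec hDB)
    (fun t => proj (phaseVec D (fun k : Fin dA => Real.sqrt (s k)) (-t)))
    fun t => isLOCC_proj_kronecker_one 1 (hnorm (-t) hA)
  -- Replacing `t` by `-t` gives both tests the same phase convention.
  rw [← Equiv.sum_comp (Equiv.neg (ZMod (2 ^ (D + 2))))] at hleft
  simp only [Equiv.neg_apply, neg_neg] at hleft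
  have hp0 : 0 ≤ (s 0 + s 1) / (2 + s 0 + s 1) := by positivity
  have hp1 : (s 0 + s 1) / (2 + s 0 + s 1) ≤ 1 := (div_le_one (by linarith)).mpr (by linarith)
  convert hdiag.mix (hright.mix hleft (g := 1 / 2) (by norm_num) (by norm_num)) hp0 hp1 using 1
  ext ⟨j, k⟩ ⟨j', k'⟩
  simp only [Matrix.add_apply, Matrix.smul_apply, Matrix.sub_apply, schmidtVec_projection_apply,
    sum_proj_kronecker_phaseVec hDA hDB, Complex.real_smul, Matrix.one_apply, diagonal_apply,
    Prod.mk.injEq]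
  have hN : Real.sqrt (2 ^ (D + 2) : ℕ) ^ 2 = (2 ^ (D + 2) : ℕ) := Real.sq_sqrt (Nat.cast_nonneg _)
  have hN0 : ((2 ^ (D + 2) : ℕ) : ℝ) ≠ 0 := by positivity
  have hN1 : ((2 ^ (D + 2) : ℕ) : ℝ) *
      ((Real.sqrt (2 ^ (D + 2) : ℕ))⁻¹ * (Real.sqrt (2 ^ (D + 2) : ℕ))⁻¹) = 1 := by
    rw [← mul_inv, ← sq, hN, mul_inv_cancel₀ hN0]
  have e1 : ∀ x y z : ℝ, ((2 ^ (D + 2) : ℕ) : ℝ) *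
      ((Real.sqrt (2 ^ (D + 2) : ℕ))⁻¹ * (Real.sqrt (2 ^ (D + 2) : ℕ))⁻¹ * (x * y)) * z
      = x * y * z := fun x y z => by rw [← mul_assoc _ _ (x * y), hN1, one_mul]
  have e2 : ∀ x y z : ℝ, ((2 ^ (D + 2) : ℕ) : ℝ) *
      (x * y * ((Real.sqrt (2 ^ (D + 2) : ℕ))⁻¹ * (Real.sqrt (2 ^ (D + 2) : ℕ))⁻¹)) * z
      = x * y * z := fun x y z => by
    rw [mul_comm (x * y), e1]
  simp only [e1, e2]
  have hS2 : 2 + s 0 + s 1 ≠ 0 := by positivity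
  have hsq : ∀ j, Real.sqrt (s j) * Real.sqrt (s j) = s j := fun j => Real.mul_self_sqrt (hs0 j)
  by_cases hjk : (j : ℕ) = k ∧ (j' : ℕ) = k'
  · have hiff : (j = j' ∧ k = k') ↔ j = j' := by
      simp only [Fin.ext_iff]; omega
    simp only [hjk, hiff, and_self, or_true, if_true, hg]
    rw [← hjk.1, ← hjk.2]
    by_cases hj : j = j'
    · subst hj
      simp only [if_true, hsq]
      push_cast
      ring
    · simp only [if_neg hj]
      push_cast
      ring
  · simp only [if_neg hjk, or_iff_left hjk]
    by_cases hd : j = j' ∧ k = k'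
    · obtain ⟨rfl, rfl⟩ := hd
      have hjk' : (j : ℕ) ≠ k := fun h => hjk ⟨h, h⟩
      simp only [and_self, if_true, hg, if_neg hjk', hsq]
      have hSc : (s 0 + s 1 : ℂ) ≠ 0 := by exact_mod_cast hS.ne'
      have hS2c : (2 + s 0 + s 1 : ℂ) ≠ 0 := by exact_mod_cast hS2
      push_cast
      field_simp
      ring
    · simp only [if_neg hd]
      simp

lemma isLOCC_homogeneous {dA dB : ℕ} (hd : 1 < min dA dB) {ψ : Ket dA dB} (hψ : ‖ψ‖ = 1)
    {s : ℕ → ℝ} (hs : HasSchmidtSpectrum ψ s) (hpos : 0 < s 0) :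
    IsLOCC (ketBra ψ + ((s 0 + s 1) / (2 + s 0 + s 1)) • (1 - ketBra ψ)) := by
  obtain ⟨U, V, hU, hV, hUV⟩ := hs.exists_unitary
  have hsum : ∑ j : Fin (min dA dB), s j = 1 := by
    rw [← norm_sq_eq_sum_spectrum hs, hψ, one_pow]
  have e0 := extZero_of_lt s (zero_lt_one.trans hd)
  have e1 := extZero_of_lt s hd
  have h := (isLOCC_homogeneous_schmidtVec (dA := dA) (dB := dB) (extZero_antitone hs.1 hs.2.1)
    (extZero_nonneg hs.2.1) (by rwa [e0])
    ((sum_extZero (min_le_left _ _) s).trans hsum)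
    ((sum_extZero (min_le_right _ _) s).trans hsum)).conj_unitary hU hV
  rw [e0, e1] at h
  convert h using 1
  rw [ketBra, hUV, vecMulVec_mulVec_star, Matrix.mul_add, Matrix.add_mul, Matrix.mul_smul,
    Matrix.smul_mul, Matrix.mul_sub, Matrix.sub_mul, Matrix.mul_one,
    kronecker_mul_conjTranspose hU hV]

/-! ### The optimal homogeneous separable verification operator -/

lemma sqrt_mul_le_first_two {s : ℕ → ℝ} (hs : Antitone s) (hs0 : ∀ j, 0 ≤ s j) {j k : ℕ}
    (h : j ≠ k) : Real.sqrt (s j) * Real.sqrt (s k) ≤ Real.sqrt (s 0 * s 1) := by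
  rw [← Real.sqrt_mul (hs0 j)]
  apply Real.sqrt_le_sqrt
  rcases lt_or_gt_of_ne h with h | h
  · exact mul_le_mul (hs (Nat.zero_le _)) (hs (by omega)) (hs0 _) (hs0 _)
  · rw [mul_comm]
    exact mul_le_mul (hs (Nat.zero_le _)) (hs (by omega)) (hs0 _) (hs0 _)

/-- With amplitudes `s ^ (1/4)` on both sides the phase average is the projector plus `√(s j * s k)`
on each `|jk⟩`, `j ≠ k`. Since `√(s 0 * s 1)` dominates all of these, a nonnegative diagonal
operator makes up the difference. -/
lemma schmidtVec_add_smul_one_mem_sepCone {dA dB : ℕ} {s : ℕ → ℝ} (hs : Antitone s)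
    (hs0 : ∀ j, 0 ≤ s j) (h1 : s 0 ≤ 1) :
    vecMulVec (schmidtVec dA dB s) (star (schmidtVec dA dB s)) +
      Real.sqrt (s 0 * s 1) • 1 ∈ sepCone dA dB := by
  set D := max dA dB
  have hDA : dA ≤ D := le_max_left _ _
  have hDB : dB ≤ D := le_max_right _ _
  set g : Fin dA × Fin dB → ℝ := fun p => Real.sqrt (s 0 * s 1) -
    if (p.1 : ℕ) = p.2 then 0 else Real.sqrt (s p.1) * Real.sqrt (s p.2) with hg
  have hq1 : Real.sqrt (s 0 * s 1) ≤ 1 :=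
    Real.sqrt_le_one.mpr (mul_le_one₀ h1 (hs0 1) ((hs zero_le_one).trans h1))
  have hdiag : (diagonal fun p => (g p : ℂ) : Op dA dB) ∈ sepCone dA dB := by
    -- Only membership in the cone is needed; `s 0 ≤ 1` makes the entries probabilities, so that the
    -- LOCC lemma applies.
    refine (isLOCC_diagonal (fun p => ?_) fun p => ?_).mem_sepCone.1
    · simp only [hg, sub_nonneg]
      split_ifs with h
      · exact Real.sqrt_nonneg _
      · exact sqrt_mul_le_first_two hs hs0 h
    · refine (sub_le_self _ ?_).trans hq1
      split_ifs <;> positivity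
  have htw : ((2 ^ (D + 2) : ℕ) : ℝ)⁻¹ • ∑ t : ZMod (2 ^ (D + 2)),
      proj (phaseVec D (fun j : Fin dA => Real.sqrt (Real.sqrt (s j))) t) ⊗ₖ
      proj (phaseVec D (fun j : Fin dB => Real.sqrt (Real.sqrt (s j))) (-t)) ∈ sepCone dA dB :=
    smul_mem_sepCone (by positivity) (sum_mem fun t _ => proj_kronecker_mem_sepCone _ _)
  convert add_mem htw hdiag using 1
  ext ⟨j, k⟩ ⟨j', k'⟩
  simp only [Matrix.add_apply, Matrix.smul_apply, schmidtVec_projection_apply,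
    sum_proj_kronecker_phaseVec hDA hDB, Complex.real_smul, Matrix.one_apply, diagonal_apply,
    Prod.mk.injEq]
  have hN0 : ((2 ^ (D + 2) : ℕ) : ℝ) ≠ 0 := by positivity
  rw [← Complex.ofReal_mul, mul_assoc, inv_mul_cancel_left₀ hN0]
  have hsq : ∀ j, Real.sqrt (Real.sqrt (s j)) * Real.sqrt (Real.sqrt (s j)) = Real.sqrt (s j) :=
    fun j => Real.mul_self_sqrt (Real.sqrt_nonneg _)
  by_cases hjk : (j : ℕ) = k ∧ (j' : ℕ) = k'
  · have hiff : (j = j' ∧ k = k') ↔ j = j' := by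
      simp only [Fin.ext_iff]; omega
    have hmul : ∀ x y : ℝ, x * y * (x * y) = x * x * (y * y) := fun x y => by ring
    simp only [hjk, hiff, and_self, or_true, if_true, hg]
    rw [← hjk.1, ← hjk.2, hmul, hsq, hsq]
    by_cases hj : j = j' <;> simp [hj]
  · simp only [if_neg hjk, or_iff_left hjk]
    by_cases hd : j = j' ∧ k = k'
    · obtain ⟨rfl, rfl⟩ := hd
      have hjk' : (j : ℕ) ≠ k := fun h => hjk ⟨h, h⟩
      simp only [and_self, if_true, hg, if_neg hjk', hsq]
      push_cast
      ring
    · simp only [if_neg hd]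
      simp

lemma ketBra_add_smul_one_mem_sepCone {dA dB : ℕ} (hd : 1 < min dA dB) {ψ : Ket dA dB}
    {s : ℕ → ℝ} (hs : HasSchmidtSpectrum ψ s) (h1 : s 0 ≤ 1) :
    ketBra ψ + Real.sqrt (s 0 * s 1) • 1 ∈ sepCone dA dB := by
  obtain ⟨U, V, hU, hV, hUV⟩ := hs.exists_unitary
  have e0 := extZero_of_lt s (zero_lt_one.trans hd)
  have e1 := extZero_of_lt s hd
  have h := conj_kronecker_mem_sepCone U V (schmidtVec_add_smul_one_mem_sepCone (dA := dA)
    (dB := dB) (extZero_antitone hs.1 hs.2.1) (extZero_nonneg hs.2.1) (by rwa [e0]))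
  rw [e0, e1, Matrix.mul_add, Matrix.add_mul, Matrix.mul_smul, Matrix.smul_mul, Matrix.mul_one,
    kronecker_mul_conjTranspose hU hV, ← vecMulVec_mulVec_star, ← hUV] at h
  exact h

/-! ### Passing probabilities -/

lemma trace_mul_ketBra_re {dA dB : ℕ} (X : Op dA dB) (φ : Ket dA dB) :
    (X * ketBra φ).trace.re = fidelity φ X := by
  rw [ketBra, mul_vecMulVec, trace_vecMulVec, dotProduct_comm, fidelity]

lemma trace_mul_re_nonneg {dA dB : ℕ} {X σ : Op dA dB} (hX : X.PosSemidef) (hσ : IsDensity σ) :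
    0 ≤ (X * σ).trace.re := by
  obtain ⟨n, p, φ, hp, -, -, rfl⟩ := exists_ensemble hσ
  rw [Finset.mul_sum, trace_sum, Complex.re_sum]
  refine Finset.sum_nonneg fun l _ => ?_
  rw [Matrix.mul_smul, trace_smul, Complex.smul_re, trace_mul_ketBra_re]
  exact mul_nonneg (hp l) (Complex.nonneg_iff.mp (hX.dotProduct_mulVec_nonneg _)).1

lemma trace_ketBra_mul_re {dA dB : ℕ} (ψ : Ket dA dB) (σ : Op dA dB) :
    (ketBra ψ * σ).trace.re = fidelity ψ σ := by
  rw [trace_mul_comm, trace_mul_ketBra_re]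

lemma star_dotProduct_self {dA dB : ℕ} {ψ : Ket dA dB} (hψ : ‖ψ‖ = 1) :
    star ψ.ofLp ⬝ᵥ ψ.ofLp = 1 := by
  rw [star_dotProduct_eq_inner, inner_self_eq_norm_sq_to_K, hψ]
  simp

lemma ketBra_mul_self {dA dB : ℕ} {ψ : Ket dA dB} (hψ : ‖ψ‖ = 1) :
    ketBra ψ * ketBra ψ = ketBra ψ := by
  rw [ketBra, vecMulVec_mul_vecMulVec, star_dotProduct_self hψ, one_smul]

lemma conjTranspose_ketBra {dA dB : ℕ} (ψ : Ket dA dB) : (ketBra ψ)ᴴ = ketBra ψ := by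
  rw [ketBra, conjTranspose_vecMulVec, star_star]

lemma ketBra_mulVec_self {dA dB : ℕ} {ψ : Ket dA dB} (hψ : ‖ψ‖ = 1) :
    ketBra ψ *ᵥ ψ.ofLp = ψ.ofLp := by
  rw [ketBra, vecMulVec_mulVec, star_dotProduct_self hψ]
  simp

lemma posSemidef_ketBra {dA dB : ℕ} (ψ : Ket dA dB) : (ketBra ψ).PosSemidef :=
  posSemidef_vecMulVec_self_star _

lemma posSemidef_one_sub_ketBra {dA dB : ℕ} {ψ : Ket dA dB} (hψ : ‖ψ‖ = 1) :
    (1 - ketBra ψ).PosSemidef := by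
  have h : 1 - ketBra ψ = (1 - ketBra ψ)ᴴ * (1 - ketBra ψ) := by
    rw [conjTranspose_sub, conjTranspose_one, conjTranspose_ketBra, sub_mul, one_mul, mul_sub,
      mul_one, ketBra_mul_self hψ, sub_self, sub_zero]
  rw [h]
  exact posSemidef_conjTranspose_mul_self _

/-- Since `Ω` is Hermitian and fixes `ψ`, it is block diagonal, and the difference is its
compression to the orthogonal complement of `ψ`. -/
lemma IsVerification.posSemidef_sub_ketBra {dA dB : ℕ} {ψ : Ket dA dB} (hψ : ‖ψ‖ = 1)
    {Ω : Op dA dB} (h : IsVerification ψ Ω) : (Ω - ketBra ψ).PosSemidef := by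
  obtain ⟨h0, -, hfix⟩ := h
  have h1 : Ω * ketBra ψ = ketBra ψ := by rw [ketBra, mul_vecMulVec, hfix]
  have h2 : ketBra ψ * Ω = ketBra ψ := by
    have := congrArg conjTranspose h1
    rwa [conjTranspose_mul, conjTranspose_ketBra, h0.isHermitian.eq] at this
  have h3 : Ω - ketBra ψ = (1 - ketBra ψ)ᴴ * Ω * (1 - ketBra ψ) := by
    rw [conjTranspose_sub, conjTranspose_one, conjTranspose_ketBra, sub_mul, one_mul, h2, mul_sub,
      mul_one, sub_mul, h1, ketBra_mul_self hψ, sub_self, sub_zero]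
  rw [h3]
  exact h0.conjTranspose_mul_mul_same _

lemma IsVerification.fidelity_le {dA dB : ℕ} {ψ : Ket dA dB} (hψ : ‖ψ‖ = 1)
    {Ω σ : Op dA dB} (h : IsVerification ψ Ω) (hσ : IsDensity σ) :
    fidelity ψ σ ≤ (Ω * σ).trace.re := by
  have := trace_mul_re_nonneg (h.posSemidef_sub_ketBra hψ) hσ
  rw [sub_mul, trace_sub, Complex.sub_re, trace_ketBra_mul_re] at this
  linarith

lemma IsVerification.trace_mul_re_le_one {dA dB : ℕ} {ψ : Ket dA dB} {Ω σ : Op dA dB}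
    (h : IsVerification ψ Ω) (hσ : IsDensity σ) : (Ω * σ).trace.re ≤ 1 := by
  have := trace_mul_re_nonneg h.2.1 hσ
  rw [sub_mul, one_mul, trace_sub, Complex.sub_re, hσ.2, Complex.one_re] at this
  linarith

lemma IsVerification.le_passProb {dA dB : ℕ} {ψ : Ket dA dB} (hψ : ‖ψ‖ = 1) {Ω : Op dA dB}
    (h : IsVerification ψ Ω) {S : Set (Op dA dB)} (hS : ∀ σ ∈ S, IsDensity σ) {F : ℝ}
    (hF : IsGreatest (fidelity ψ '' S) F) : F ≤ passProb Ω S := by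
  obtain ⟨⟨σ, hσ, rfl⟩, -⟩ := hF
  refine (h.fidelity_le hψ (hS σ hσ)).trans (le_csSup ⟨1, ?_⟩ ⟨σ, hσ, rfl⟩)
  rintro _ ⟨τ, hτ, rfl⟩
  exact h.trace_mul_re_le_one (hS τ hτ)

/-- The homogeneous operator `|ψ⟩⟨ψ| + β (1 - |ψ⟩⟨ψ|)`. -/
def homogeneousOp {dA dB : ℕ} (ψ : Ket dA dB) (β : ℝ) : Op dA dB :=
  ketBra ψ + β • (1 - ketBra ψ)

lemma one_sub_homogeneousOp {dA dB : ℕ} (ψ : Ket dA dB) (β : ℝ) :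
    1 - homogeneousOp ψ β = (1 - β) • (1 - ketBra ψ) := by
  rw [homogeneousOp, sub_smul, one_smul, sub_add_eq_sub_sub]

lemma isVerification_homogeneousOp {dA dB : ℕ} {ψ : Ket dA dB} (hψ : ‖ψ‖ = 1) {β : ℝ}
    (h0 : 0 ≤ β) (h1 : β ≤ 1) : IsVerification ψ (homogeneousOp ψ β) := by
  refine ⟨(posSemidef_ketBra ψ).add ((posSemidef_one_sub_ketBra hψ).smul h0), ?_, ?_⟩
  · rw [one_sub_homogeneousOp]
    exact (posSemidef_one_sub_ketBra hψ).smul (sub_nonneg.mpr h1)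
  · rw [homogeneousOp, add_mulVec, smul_mulVec, sub_mulVec, one_mulVec, ketBra_mulVec_self hψ,
      sub_self, smul_zero, add_zero]

lemma passProb_homogeneousOp {dA dB : ℕ} (ψ : Ket dA dB) {β : ℝ} (h1 : β ≤ 1)
    {S : Set (Op dA dB)} (hS : ∀ σ ∈ S, IsDensity σ) {F : ℝ}
    (hF : IsGreatest (fidelity ψ '' S) F) :
    passProb (homogeneousOp ψ β) S = β + (1 - β) * F := by
  have key : ∀ σ ∈ S, (homogeneousOp ψ β * σ).trace.re = β + (1 - β) * fidelity ψ σ := by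
    intro σ hσ
    rw [homogeneousOp, add_mul, smul_mul, sub_mul, one_mul, trace_add, trace_smul, trace_sub,
      (hS σ hσ).2, Complex.add_re, Complex.smul_re, Complex.sub_re, trace_ketBra_mul_re,
      Complex.one_re, smul_eq_mul]
    ring
  refine IsGreatest.csSup_eq ⟨?_, ?_⟩
  · obtain ⟨⟨σ, hσ, rfl⟩, -⟩ := hF
    exact ⟨σ, hσ, key σ hσ⟩
  · rintro _ ⟨σ, hσ, rfl⟩
    simp only [key σ hσ]
    have := mul_le_mul_of_nonneg_left (hF.2 ⟨σ, hσ, rfl⟩) (sub_nonneg.mpr h1)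
    linarith

/-! ### The separability bound for homogeneous operators -/

lemma fidelity_one {dA dB : ℕ} {f : Ket dA dB} (hf : ‖f‖ = 1) : fidelity f 1 = 1 := by
  rw [fidelity, one_mulVec, star_dotProduct_self hf, Complex.one_re]

/-- The expectation of the partial transpose of the singlet projector, for product vectors
`f j k = a j ⊗ b k`. -/
def singletWitness {dA dB : ℕ} (f : Fin 2 → Fin 2 → Ket dA dB) (X : Op dA dB) : ℝ :=
  fidelity (f 0 1) X + fidelity (f 1 0) X - 2 * (star (f 0 0).ofLp ⬝ᵥ X *ᵥ (f 1 1).ofLp).re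

lemma singletWitness_add {dA dB : ℕ} (f : Fin 2 → Fin 2 → Ket dA dB) (X Y : Op dA dB) :
    singletWitness f (X + Y) = singletWitness f X + singletWitness f Y := by
  simp only [singletWitness, fidelity_add, add_mulVec, dotProduct_add, Complex.add_re]
  ring

lemma singletWitness_smul {dA dB : ℕ} (f : Fin 2 → Fin 2 → Ket dA dB) (c : ℝ) (X : Op dA dB) :
    singletWitness f (c • X) = c * singletWitness f X := by
  simp only [singletWitness, fidelity_smul, smul_mulVec, dotProduct_smul, Complex.smul_re,
    smul_eq_mul]
  ring

lemma singletWitness_ketBra {dA dB : ℕ} (f : Fin 2 → Fin 2 → Ket dA dB) (φ : Ket dA dB) :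
    singletWitness f (ketBra φ) = ‖inner ℂ (f 0 1) φ‖ ^ 2 + ‖inner ℂ (f 1 0) φ‖ ^ 2 -
      2 * (inner ℂ (f 0 0) φ * inner ℂ φ (f 1 1)).re := by
  rw [singletWitness, fidelity_ketBra, fidelity_ketBra, ketBra, vecMulVec_mulVec, op_smul_eq_smul,
    dotProduct_smul, star_dotProduct_eq_inner, star_dotProduct_eq_inner, smul_eq_mul,
    mul_comm (inner ℂ φ _)]

/-- On a product vector the cross term has modulus `x * y`, where `x ^ 2` and `y ^ 2` are the two
fidelities, so the claim is `2 * x * y ≤ x ^ 2 + y ^ 2`; convexity does the rest. -/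
lemma singletWitness_nonneg_of_isSeparableOp {dA dB : ℕ} (a : Fin 2 → EuclideanSpace ℂ (Fin dA))
    (b : Fin 2 → EuclideanSpace ℂ (Fin dB)) {X : Op dA dB} (hX : IsSeparableOp X) :
    0 ≤ singletWitness (fun j k => tens (a j) (b k)) X := by
  obtain ⟨c, hc, σ, hσ, rfl⟩ := hX
  rw [singletWitness_smul]
  refine mul_nonneg hc ?_
  have hconv : Convex ℝ {σ : Op dA dB |
      0 ≤ singletWitness (fun j k => tens (a j) (b k)) σ} := by
    intro σ hσ τ hτ x y hx hy _
    simp only [Set.mem_ofPred_eq, singletWitness_add, singletWitness_smul] at *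
    positivity
  refine convexHull_min ?_ hconv hσ
  rintro _ ⟨u, v, φ, -, -, hφ, rfl⟩
  obtain rfl : φ = tens u v := by
    ext ⟨i, k⟩
    exact hφ i k
  rw [Set.mem_ofPred_eq, singletWitness_ketBra]
  simp only [inner_tens, norm_mul]
  have h1 := Complex.re_le_norm (inner ℂ (a 0) u * inner ℂ (b 0) v *
    (inner ℂ u (a 1) * inner ℂ v (b 1)))
  simp only [norm_mul, norm_inner_symm u, norm_inner_symm v] at h1
  have h2 := two_mul_le_add_sq (‖inner ℂ (a 0) u‖ * ‖inner ℂ (b 1) v‖)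
    (‖inner ℂ (a 1) u‖ * ‖inner ℂ (b 0) v‖)
  linarith

lemma inner_tens_eq_of_spectrum {dA dB : ℕ} {ψ : Ket dA dB} {s : ℕ → ℝ}
    {a : Fin (min dA dB) → EuclideanSpace ℂ (Fin dA)}
    {b : Fin (min dA dB) → EuclideanSpace ℂ (Fin dB)} (ha : Orthonormal ℂ a)
    (hb : Orthonormal ℂ b)
    (h : ∀ (i : Fin dA) (k : Fin dB),
      ψ (i, k) = ∑ j : Fin (min dA dB), (Real.sqrt (s j) : ℂ) * (a j i * b j k))
    (j k : Fin (min dA dB)) :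
    inner ℂ (tens (a j) (b k)) ψ = if j = k then (Real.sqrt (s j) : ℂ) else 0 := by
  rw [eq_sum_tens h]
  simp only [inner_sum, inner_smul_right, inner_tens, orthonormal_iff_ite.mp ha,
    orthonormal_iff_ite.mp hb]
  rw [Finset.sum_eq_single j (fun l _ hl => by simp [hl.symm]) (by simp)]
  simp [eq_comm]

lemma norm_tens {dA dB : ℕ} {u : EuclideanSpace ℂ (Fin dA)} {v : EuclideanSpace ℂ (Fin dB)}
    (hu : ‖u‖ = 1) (hv : ‖v‖ = 1) : ‖tens u v‖ = 1 := by
  have h : ‖tens u v‖ ^ 2 = 1 := by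
    rw [← inner_self_eq_norm_sq (𝕜 := ℂ), inner_tens, inner_self_eq_norm_sq_to_K,
      inner_self_eq_norm_sq_to_K, hu, hv]
    simp
  exact (pow_eq_one_iff_of_nonneg (norm_nonneg _) two_ne_zero).mp h

/-- On the two leading Schmidt directions the witness is `-2 * √(s 0 * s 1)` at the projector and
`2` at the identity; positivity on their combination bounds `β`. -/
lemma le_of_isSeparableOp_homogeneousOp {dA dB : ℕ} (hd : 1 < min dA dB) {ψ : Ket dA dB}
    {s : ℕ → ℝ} (hs : HasSchmidtSpectrum ψ s) {β : ℝ}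
    (h : IsSeparableOp (homogeneousOp ψ β)) :
    Real.sqrt (s 0 * s 1) / (1 + Real.sqrt (s 0 * s 1)) ≤ β := by
  obtain ⟨-, hs0, a, b, ha, hb, hab⟩ := hs
  set ι : Fin 2 → Fin (min dA dB) := Fin.castLE hd with hι
  have h01 : ι 0 ≠ ι 1 := by simp [hι, Fin.ext_iff]
  have hW := singletWitness_nonneg_of_isSeparableOp (a ∘ ι) (b ∘ ι) h
  have hin := inner_tens_eq_of_spectrum ha hb hab
  have hψW : singletWitness (fun j k => tens ((a ∘ ι) j) ((b ∘ ι) k)) (ketBra ψ)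
      = -2 * Real.sqrt (s 0 * s 1) := by
    rw [singletWitness_ketBra, ← inner_conj_symm ψ]
    simp only [Function.comp_apply, hin, if_neg h01, if_neg h01.symm, if_true, Complex.conj_ofReal]
    rw [← Complex.ofReal_mul, Complex.ofReal_re, Real.sqrt_mul (hs0 0 (by omega))]
    simp [hι]
  have h1W : singletWitness (fun j k => tens ((a ∘ ι) j) ((b ∘ ι) k)) (1 : Op dA dB) = 2 := by
    simp only [singletWitness, Function.comp_apply]
    rw [fidelity_one (norm_tens (ha.1 _) (hb.1 _)), fidelity_one (norm_tens (ha.1 _) (hb.1 _)),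
      one_mulVec, star_dotProduct_eq_inner, inner_tens]
    simp only [orthonormal_iff_ite.mp ha, if_neg h01]
    norm_num
  have hlin : homogeneousOp ψ β = (1 - β) • ketBra ψ + β • 1 := by
    rw [homogeneousOp, smul_sub, sub_smul, one_smul]
    abel
  rw [hlin, singletWitness_add, singletWitness_smul, singletWitness_smul, hψW, h1W] at hW
  have hq := Real.sqrt_nonneg (s 0 * s 1)
  rw [div_le_iff₀ (by linarith)]
  linarith

/-! ### Comparison of the separation probabilities -/

lemma locc_bound_le {x y F : ℝ} (hy : 0 ≤ y) (hyx : y ≤ x) (hx : x ≤ 1) (hxF : x ≤ F) :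
    (2 * F + x + y) / (2 + x + y) ≤ 2 / (1 + x) * F := by
  have hx0 : 0 ≤ x := hy.trans hyx
  rw [div_mul_eq_mul_div, div_le_div_iff₀ (by linarith) (by linarith)]
  -- After clearing denominators the difference is `2 * (F - x) * (1 + y) + (x - y) * (1 - x)`.
  nlinarith [mul_nonneg (sub_nonneg.mpr hyx) (sub_nonneg.mpr hx),
    mul_nonneg (sub_nonneg.mpr hxF) (by linarith : 0 ≤ 1 + y)]

/-- With `x = √s₀` and `y = √s₁` the cleared inequality is polynomial and affine in `F`, so it
suffices to check `F = 1` (`e1`) and `F = x ^ 2` (`e2`) and interpolate. -/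
lemma locc_bound_le_of_sq {x y F : ℝ} (hy : 0 ≤ y) (hyx : y ≤ x) (hx : x ≤ 1) (hxF : x ^ 2 ≤ F)
    (hF : F ≤ 1) :
    (2 * F + x ^ 2 + y ^ 2) / (2 + x ^ 2 + y ^ 2) ≤
      3 / (2 + x ^ 2) * ((F + x * y) / (1 + x * y)) := by
  have hx0 : 0 ≤ x := hy.trans hyx
  have hxy : 0 ≤ x * y := mul_nonneg hx0 hy
  have hx2 : x ^ 2 ≤ 1 := pow_le_one₀ hx0 hx
  rw [div_mul_div_comm, div_le_div_iff₀ (by positivity) (by positivity)]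
  -- At `x ^ 2 = 1` the interval for `F` is a point, and the interpolation identity, which carries a
  -- factor `1 - x ^ 2`, is useless.
  rcases hx2.eq_or_lt with h1 | h1
  · have hF1 : F = 1 := le_antisymm hF (h1 ▸ hxF)
    rw [hF1, h1]
    linarith
  have e1 : 0 ≤ 3 * (1 + x * y) * (2 + x ^ 2 + y ^ 2) -
      (2 + x ^ 2 + y ^ 2) * ((2 + x ^ 2) * (1 + x * y)) := by
    have : 0 ≤ (1 + x * y) * (2 + x ^ 2 + y ^ 2) * (1 - x ^ 2) :=
      mul_nonneg (by positivity) (by linarith)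
    linarith
  have e2 : 0 ≤ 3 * (x ^ 2 + x * y) * (2 + x ^ 2 + y ^ 2) -
      (3 * x ^ 2 + y ^ 2) * ((2 + x ^ 2) * (1 + x * y)) := by
    have h3 : 0 ≤ -2 * y + x * y ^ 2 + 3 * x * (2 + x ^ 2) := by
      have : 0 ≤ x * y ^ 2 := by positivity
      have : 0 ≤ x * x ^ 2 := by positivity
      linarith
    have : 0 ≤ y * (1 - x ^ 2) * (-2 * y + x * y ^ 2 + 3 * x * (2 + x ^ 2)) :=
      mul_nonneg (mul_nonneg hy (by linarith)) h3
    linarith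
  have h4 := mul_nonneg (sub_nonneg.mpr hxF) e1
  have h5 := mul_nonneg (sub_nonneg.mpr hF) e2
  have h6 : (1 - x ^ 2) * (3 * (F + x * y) * (2 + x ^ 2 + y ^ 2) -
      (2 * F + x ^ 2 + y ^ 2) * ((2 + x ^ 2) * (1 + x * y))) =
      (F - x ^ 2) * (3 * (1 + x * y) * (2 + x ^ 2 + y ^ 2) -
        (2 + x ^ 2 + y ^ 2) * ((2 + x ^ 2) * (1 + x * y))) +
      (1 - F) * (3 * (x ^ 2 + x * y) * (2 + x ^ 2 + y ^ 2) -
        (3 * x ^ 2 + y ^ 2) * ((2 + x ^ 2) * (1 + x * y))) := by ring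
  have h7 := nonneg_of_mul_nonneg_right (h6 ▸ add_nonneg h4 h5) (by linarith)
  linarith

lemma locc_bound_le_sep_bound {s₀ s₁ F : ℝ} (h1 : 0 ≤ s₁) (h10 : s₁ ≤ s₀) (h0 : s₀ ≤ 1)
    (hF0 : s₀ ≤ F) (hF : F ≤ 1) :
    (2 * F + s₀ + s₁) / (2 + s₀ + s₁) ≤
      3 / (2 + s₀) * ((F + Real.sqrt (s₀ * s₁)) / (1 + Real.sqrt (s₀ * s₁))) := by
  have hs0 := h1.trans h10
  have h := locc_bound_le_of_sq (x := Real.sqrt s₀) (y := Real.sqrt s₁) (Real.sqrt_nonneg _)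
    (Real.sqrt_le_sqrt h10) (Real.sqrt_le_one.mpr h0) (by rwa [Real.sq_sqrt hs0]) hF
  rwa [Real.sq_sqrt hs0, Real.sq_sqrt h1, ← Real.sqrt_mul hs0] at h

lemma spectrum_zero_pos {dA dB : ℕ} {ψ : Ket dA dB} (hψ : ‖ψ‖ = 1) {s : ℕ → ℝ}
    (hs : HasSchmidtSpectrum ψ s) : 0 < s 0 := by
  have hsum := norm_sq_eq_sum_spectrum hs
  rw [hψ, one_pow] at hsum
  by_contra! h
  refine absurd (Finset.sum_nonpos fun (j : Fin (min dA dB)) _ => ?_) (by rw [← hsum]; norm_num)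
  exact (hs.1 (Set.mem_Iio.mpr (Nat.zero_lt_of_lt j.2)) j.2 (Nat.zero_le _)).trans h

lemma spectrum_zero_le {dA dB r : ℕ} (hr : 1 ≤ r) (hrd : r < min dA dB) {ψ : Ket dA dB}
    (hψ : ‖ψ‖ = 1) {s : ℕ → ℝ} (hs : HasSchmidtSpectrum ψ s) :
    s 0 ≤ 1 - ∑ j ∈ Finset.Ico r (min dA dB), s j := by
  rw [← sum_range_spectrum hrd hψ hs]
  exact Finset.single_le_sum (f := s) (fun j hj => hs.2.1 j ((Finset.mem_range.mp hj).trans hrd))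
    (Finset.mem_range.mpr hr)

lemma fidelity_le_one {dA dB : ℕ} {ψ : Ket dA dB} (hψ : ‖ψ‖ = 1) {σ : Op dA dB}
    (hσ : IsDensity σ) : fidelity ψ σ ≤ 1 := by
  have h := isVerification_homogeneousOp hψ zero_le_one le_rfl
  exact (h.fidelity_le hψ hσ).trans (h.trace_mul_re_le_one hσ)

lemma separation_probabilities {dA dB : ℕ} (hd : 1 < min dA dB) {ψ : Ket dA dB} (hψ : ‖ψ‖ = 1)
    {s : ℕ → ℝ} (hs : HasSchmidtSpectrum ψ s) {S : Set (Op dA dB)}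
    (hS : ∀ σ ∈ S, IsDensity σ) {F : ℝ} (hF : IsGreatest (fidelity ψ '' S) F) (hsF : s 0 ≤ F) :
    (F ≤ Psep ψ S ∧ Psep ψ S ≤ PLC ψ S ∧
      PLC ψ S ≤ (2 * F + s 0 + s 1) / (2 + s 0 + s 1) ∧
      (2 * F + s 0 + s 1) / (2 + s 0 + s 1) ≤ 2 / (1 + s 0) * F) ∧
    ((F + Real.sqrt (s 0 * s 1)) / (1 + Real.sqrt (s 0 * s 1)) = PsepH ψ S ∧
      PsepH ψ S ≤ PLCH ψ S ∧
      PLCH ψ S ≤ (2 * F + s 0 + s 1) / (2 + s 0 + s 1) ∧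
      (2 * F + s 0 + s 1) / (2 + s 0 + s 1) ≤ 3 / (2 + s 0) * PsepH ψ S) := by
  have hA : 0 < dA := by omega
  have hB : 0 < dB := by omega
  have hpos := spectrum_zero_pos hψ hs
  have hs1 : 0 ≤ s 1 := hs.2.1 1 hd
  have hs10 : s 1 ≤ s 0 := hs.1 (Set.mem_Iio.mpr (by omega)) (Set.mem_Iio.mpr hd) zero_le_one
  have hF1 : F ≤ 1 := by
    obtain ⟨⟨σ, hσ, rfl⟩, -⟩ := hF
    exact fidelity_le_one hψ (hS σ hσ)
  have hs01 : s 0 ≤ 1 := hsF.trans hF1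
  set q := Real.sqrt (s 0 * s 1) with hq
  have hq0 : 0 ≤ q := Real.sqrt_nonneg _
  set β := (s 0 + s 1) / (2 + s 0 + s 1) with hβ
  have hden : 0 < 2 + s 0 + s 1 := by linarith
  have hβ0 : 0 ≤ β := div_nonneg (by linarith) hden.le
  have hβ1 : β < 1 := (div_lt_one hden).mpr (by linarith)
  have hlocc : IsLOCC (homogeneousOp ψ β) := isLOCC_homogeneous hd hψ hs hpos
  have hΩ : IsLocalVerification ψ (homogeneousOp ψ β) :=
    ⟨isVerification_homogeneousOp hψ hβ0 hβ1.le, hlocc⟩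
  have hΩH : IsHomogeneous ψ (homogeneousOp ψ β) := ⟨β, hβ0, hβ1, rfl⟩
  have hpass : passProb (homogeneousOp ψ β) S = (2 * F + s 0 + s 1) / (2 + s 0 + s 1) := by
    rw [passProb_homogeneousOp ψ hβ1.le hS hF, hβ]
    field_simp
    ring
  have hloc_sep : ∀ Ω, IsLocalVerification ψ Ω → IsSepVerification ψ Ω := fun Ω h =>
    ⟨h.1, isSeparableOp_of_mem_sepCone hA hB h.2.mem_sepCone.1,
      isSeparableOp_of_mem_sepCone hA hB h.2.mem_sepCone.2⟩
  have hle : ∀ Ω, IsVerification ψ Ω → F ≤ passProb Ω S := fun Ω h => h.le_passProb hψ hS hF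
  have hsepH : PsepH ψ S = (F + q) / (1 + q) := by
    have hγ0 : 0 ≤ q / (1 + q) := by positivity
    have hγ1 : q / (1 + q) < 1 := (div_lt_one (by linarith)).mpr (by linarith)
    have hval : q / (1 + q) + (1 - q / (1 + q)) * F = (F + q) / (1 + q) := by
      field_simp
      ring
    refine IsLeast.csInf_eq ⟨⟨homogeneousOp ψ (q / (1 + q)),
      ⟨⟨isVerification_homogeneousOp hψ hγ0 hγ1.le, ?_, ?_⟩, _, hγ0, hγ1, rfl⟩, ?_⟩, ?_⟩
    · have h := smul_mem_sepCone (inv_nonneg.mpr (by positivity : 0 ≤ 1 + q))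
        (ketBra_add_smul_one_mem_sepCone hd hs hs01)
      refine isSeparableOp_of_mem_sepCone hA hB ?_
      convert h using 1
      have e : (1 + q)⁻¹ = 1 - q / (1 + q) := by field_simp; ring
      rw [homogeneousOp, ← hq, smul_add, smul_smul, inv_mul_eq_div, e, smul_sub, sub_smul, one_smul]
      abel
    -- All complements of homogeneous operators are multiples of one operator, so separability is
    -- inherited from the complement of the LOCC test.
    · have h := smul_mem_sepCone (div_nonneg (sub_nonneg.mpr hγ1.le) (sub_nonneg.mpr hβ1.le))
        hlocc.mem_sepCone.2
      refine isSeparableOp_of_mem_sepCone hA hB ?_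
      rwa [one_sub_homogeneousOp, smul_smul, div_mul_cancel₀ _ (sub_pos.mpr hβ1).ne',
        ← one_sub_homogeneousOp] at h
    · simp only [passProb_homogeneousOp ψ hγ1.le hS hF, hval]
    -- The value `γ + (1 - γ) F` is nondecreasing in `γ` because `F ≤ 1`, so the witness bound on
    -- `γ` decides the minimum.
    · rintro _ ⟨Ω, ⟨⟨-, hsep, -⟩, γ, -, hγ1, rfl⟩, rfl⟩
      have hγ := le_of_isSeparableOp_homogeneousOp hd hs hsep
      have e := passProb_homogeneousOp ψ hγ1.le hS hF
      rw [homogeneousOp] at e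
      simp only [e, ← hval]
      have := mul_le_mul_of_nonneg_right hγ (sub_nonneg.mpr hF1)
      linarith
  refine ⟨⟨?_, ?_, ?_, locc_bound_le hs1 hs10 hs01 hsF⟩, hsepH.symm, ?_, ?_, ?_⟩
  · refine le_csInf ⟨_, _, hloc_sep _ hΩ, rfl⟩ ?_
    rintro _ ⟨Ω, h, rfl⟩
    exact hle Ω h.1
  -- The explicit LOCC operator makes the smaller set nonempty, without which the real infimum would
  -- default to `0`.
  · refine csInf_le_csInf ⟨F, ?_⟩ ⟨_, _, hΩ, rfl⟩ (Set.image_mono fun Ω h => hloc_sep Ω h)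
    rintro _ ⟨Ω, h, rfl⟩
    exact hle Ω h.1
  · rw [← hpass]
    refine csInf_le ⟨F, ?_⟩ ⟨_, hΩ, rfl⟩
    rintro _ ⟨Ω, h, rfl⟩
    exact hle Ω h.1
  · refine csInf_le_csInf ⟨F, ?_⟩ ⟨_, _, ⟨hΩ, hΩH⟩, rfl⟩
      (Set.image_mono fun Ω h => ⟨hloc_sep Ω h.1, h.2⟩)
    rintro _ ⟨Ω, h, rfl⟩
    exact hle Ω h.1.1
  · rw [← hpass]
    refine csInf_le ⟨F, ?_⟩ ⟨_, ⟨hΩ, hΩH⟩, rfl⟩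
    rintro _ ⟨Ω, h, rfl⟩
    exact hle Ω h.1.1
  · rw [hsepH]
    exact locc_bound_le_sep_bound hs1 hs10 hs01 hsF hF1

end

end QCert

/-! ### Specialization to the two families of states -/

theorem mainTheorem3 (dA dB r : ℕ) (hr : 1 ≤ r) (hrd : r < min dA dB)
    (ψ : Ket dA dB) (hψ : ‖ψ‖ = 1) (s : ℕ → ℝ) (hs : HasSchmidtSpectrum ψ s)
    (Er : ℝ) (hEr : Er = ∑ j ∈ Finset.Ico r (min dA dB), s j) :
    -- bounds for the separation probabilities against `S_r`
    ((1 - Er ≤ Psep ψ (schmidtSet dA dB r) ∧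
      Psep ψ (schmidtSet dA dB r) ≤ PLC ψ (schmidtSet dA dB r) ∧
      PLC ψ (schmidtSet dA dB r) ≤ 1 - 2 * Er / (2 + s 0 + s 1) ∧
      1 - 2 * Er / (2 + s 0 + s 1) ≤ 2 / (1 + s 0) * (1 - Er)) ∧
     (1 - Er / (1 + Real.sqrt (s 0 * s 1)) = PsepH ψ (schmidtSet dA dB r) ∧
      PsepH ψ (schmidtSet dA dB r) ≤ PLCH ψ (schmidtSet dA dB r) ∧
      PLCH ψ (schmidtSet dA dB r) ≤ 1 - 2 * Er / (2 + s 0 + s 1) ∧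
      1 - 2 * Er / (2 + s 0 + s 1) ≤ 3 / (2 + s 0) * PsepH ψ (schmidtSet dA dB r))) ∧
    -- bounds for the separation probabilities against `S_{E_r}(E)`
    (∀ E : ℝ, 0 ≤ E → E < Er →
      fr r ψ E = (Real.sqrt (Er * E) + Real.sqrt ((1 - Er) * (1 - E))) ^ 2 ∧
      (fr r ψ E ≤ Psep ψ (limitedEntSet dA dB r E) ∧
       Psep ψ (limitedEntSet dA dB r E) ≤ PLC ψ (limitedEntSet dA dB r E) ∧
       PLC ψ (limitedEntSet dA dB r E) ≤ (2 * fr r ψ E + s 0 + s 1) / (2 + s 0 + s 1) ∧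
       (2 * fr r ψ E + s 0 + s 1) / (2 + s 0 + s 1) ≤ 2 / (1 + s 0) * fr r ψ E) ∧
      ((fr r ψ E + Real.sqrt (s 0 * s 1)) / (1 + Real.sqrt (s 0 * s 1))
          = PsepH ψ (limitedEntSet dA dB r E) ∧
       PsepH ψ (limitedEntSet dA dB r E) ≤ PLCH ψ (limitedEntSet dA dB r E) ∧
       PLCH ψ (limitedEntSet dA dB r E) ≤ (2 * fr r ψ E + s 0 + s 1) / (2 + s 0 + s 1) ∧
       (2 * fr r ψ E + s 0 + s 1) / (2 + s 0 + s 1)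
          ≤ 3 / (2 + s 0) * PsepH ψ (limitedEntSet dA dB r E))) := by
  have hd : 1 < min dA dB := hr.trans_lt hrd
  have hpos := spectrum_zero_pos hψ hs
  -- As `r ≥ 1`, the coefficient `s 0` belongs to the head. With `s 0 > 0` this gives `Er < 1`,
  -- needed to rescale the head by `1 / (1 - Er)`.
  have hs0Er : s 0 ≤ 1 - Er := hEr ▸ spectrum_zero_le hr hrd hψ hs
  have hEr1 : Er < 1 := by linarith
  constructor
  · have hs1 : 0 ≤ s 1 := hs.2.1 1 hd
    have hden : 2 + s 0 + s 1 ≠ 0 := by positivity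
    have hq : 1 + Real.sqrt (s 0 * s 1) ≠ 0 := by positivity
    have e1 : 1 - 2 * Er / (2 + s 0 + s 1) =
        (2 * (1 - Er) + s 0 + s 1) / (2 + s 0 + s 1) := by
      field_simp
      ring
    have e2 : 1 - Er / (1 + Real.sqrt (s 0 * s 1)) =
        (1 - Er + Real.sqrt (s 0 * s 1)) / (1 + Real.sqrt (s 0 * s 1)) := by
      field_simp
      ring
    rw [e1, e2]
    exact separation_probabilities hd hψ hs (fun σ => isDensity_of_mem_schmidtSet)
      (isGreatest_fidelity_schmidtSet hrd hψ hs hEr hEr1) hs0Er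
  · intro E hE hEEr
    have hgreat := isGreatest_fidelity_limitedEntSet hrd hψ hs hEr hEr1 hE hEEr
    have hfr : fr r ψ E = fidelityBound Er E := hgreat.csSup_eq
    rw [hfr]
    exact ⟨rfl, separation_probabilities hd hψ hs (fun σ hσ => hσ.1) hgreat
      (hs0Er.trans (one_sub_le_fidelityBound hrd hψ hs hEr hEr1 hE hEEr))⟩
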